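/- **Lemma (geometric convergence of $\alpha$).** Let $\mathbb K$ be the line $\mathbb R$ or the circle $\mathbb T=\mathbb R/2\pi\mathbb Z$, and let $q$ be a complex-valued function on $\mathbb K$, a Schwartz function if $\mathbb K=\mathbb R$ and a smooth function if $\mathbb K=\mathbb T$. For $\kappa>0$ let $(\kappa\mp\partial)^{-1}$ be the bounded Fourier multipliers on $L^2(\mathbb K)$ with symbols $(\kappa\mp i\xi)^{-1}$, and identify $q,\bar q$ with the corresponding multiplication operators. Put $$T_{\kappa,q}=(\kappa-\partial)^{-1}\,q\,(\kappa+\partial)^{-1}\,\bar q ,\qquad \alpha_l(\kappa;q)=\frac{(-1)^l\, i^{\,l+1}\kappa^l}{l}\,\mathrm{tr}\big(T_{\kappa,q}^{\,l}\big)\quad(l\ge 1),\qquad \alpha(\kappa;q)=\mathrm{Re}\sum_{l\ge1}\alpha_l(\kappa;q).$$ We say that $\alpha(\kappa;q)$ *converges geometrically with ratio* $r\in[0,1)$ if $T_{\kappa,q}^{\,l}$ is trace class for every $l\ge1$ and there is a constant $M$ (which may depend on $\kappa$ and $q$) with $|\alpha_l(\kappa;q)|\le M r^l$ for all $l\ge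 1$; in particular the series then converges absolutely, and $\alpha(\kappa;q)=\sum_{l\ge1}\mathrm{Re}\,\alpha_l(\kappa;q)$. Let $\|q\|_{H^s}$ be the inhomogeneous Sobolev norm, $\|q\|_{H^s}^2=\int(1+\xi^2)^s|\hat q(\xi)|^2\,d\xi$ on $\mathbb R$ and $\|q\|_{H^s}^2=\sum_{n\in\mathbb Z}(1+n^2)^s|\hat q(n)|^2$ on $\mathbb T$, with $\hat q(\xi)=(2\pi)^{-1/2}\int_{\mathbb K}q(x)e^{-ix\xi}\,dx$, and for $s>0$ put $a=\min(1/4,s)$. 1. (Line, small mass.) There are $c>0$ and $r\in[0,1)$ such that for all $\kappa>0$ and all Schwartz $q$ with $\|q\|_{L^2}\le c$, $\alpha(\kappa;q)$ converges geometrically with ratio $r$. 2. (Line, large $\kappa$.) For every $s>0$ there are $C>0$ and $r\in[0,1)$ such that for all $\kappa>0$ and all Schwartz $q$ with $\kappa\ge C\|q\|_{H^s}^{1/a}$, $\alpha(\kappa;q)$ converges geometrically with ratio $r$. 3. (Circle, small mass.) For every $\kappa_0>0$ there are $c>0$ and $r\in[0,1)$ such that for all $\kappa\ge\kappa_0$ and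 all smooth $q$ on $\mathbb T$ with $\|q\|_{L^2}\le c$, $\alpha(\kappa;q)$ converges geometrically with ratio $r$. 4. (Circle, large $\kappa$.) For every $\kappa_0>0$ and $s>0$ there are $C>0$ and $r\in[0,1)$ such that for all $\kappa\ge\kappa_0$ and all smooth $q$ on $\mathbb T$ with $\kappa\ge C\|q\|_{H^s}^{1/a}$, $\alpha(\kappa;q)$ converges geometrically with ratio $r$. -/

import Mathlib

open MeasureTheory FourierTransform
open scoped SchwartzMap ENNReal ContDiff

noncomputable section

/-! ## Trace class operators and their trace -/

section TraceClass

variable {H : Type*} [NormedAddCommGroup H] [InnerProductSpace ℂ H]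

/-- A bounded operator on a Hilbert space is trace class (equivalently, nuclear) if it is an
absolutely convergent sum of rank-one operators: `T v = ∑ₙ ⟪yₙ, v⟫ xₙ` with
`∑ₙ ‖xₙ‖ ‖yₙ‖ < ∞`. -/
def IsTraceClass (T : H →L[ℂ] H) : Prop :=
  ∃ x y : ℕ → H, Summable (fun n => ‖x n‖ * ‖y n‖) ∧
    ∀ v, HasSum (fun n => inner ℂ (y n) v • x n) (T v)

theorem sum_norm_inner_mul_inner_le {ι : Type*} (b : HilbertBasis ι ℂ H) (x y : H)
    (s : Finset ι) : ∑ i ∈ s, ‖inner ℂ y (b i) * inner ℂ (b i) x‖ ≤ ‖x‖ * ‖y‖ := by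
  have bessel : ∀ z : H, √(∑ i ∈ s, ‖inner ℂ (b i) z‖ ^ 2) ≤ ‖z‖ := fun z =>
    Real.sqrt_le_left (norm_nonneg z) |>.2 (b.orthonormal.sum_inner_products_le z)
  calc ∑ i ∈ s, ‖inner ℂ y (b i) * inner ℂ (b i) x‖
      = ∑ i ∈ s, ‖inner ℂ (b i) x‖ * ‖inner ℂ (b i) y‖ := by
        refine Finset.sum_congr rfl fun i _ => ?_
        rw [norm_mul, norm_inner_symm y, mul_comm]
    _ ≤ √(∑ i ∈ s, ‖inner ℂ (b i) x‖ ^ 2) * √(∑ i ∈ s, ‖inner ℂ (b i) y‖ ^ 2) :=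
        Real.sum_mul_le_sqrt_mul_sqrt s _ _
    _ ≤ ‖x‖ * ‖y‖ := mul_le_mul (bessel x) (bessel y) (Real.sqrt_nonneg _) (norm_nonneg _)

theorem hasSum_trace_of_nuclear {T : H →L[ℂ] H} {x y : ℕ → H}
    (hs : Summable (fun n => ‖x n‖ * ‖y n‖))
    (hT : ∀ v, HasSum (fun n => inner ℂ (y n) v • x n) (T v))
    {ι : Type*} (b : HilbertBasis ι ℂ H) :
    HasSum (fun i => inner ℂ (b i) (T (b i))) (∑' n, inner ℂ (y n) (x n)) := by
  set F : ℕ × ι → ℂ := fun p => inner ℂ (y p.1) (b p.2) * inner ℂ (b p.2) (x p.1) with hF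
  have hfib : ∀ n, Summable fun i => ‖F (n, i)‖ := fun n =>
    summable_of_sum_le (fun _ => norm_nonneg _) (sum_norm_inner_mul_inner_le b (x n) (y n))
  have hsum : Summable F := by
    refine Summable.of_norm ((summable_prod_of_nonneg (fun _ => norm_nonneg _)).2 ⟨hfib, ?_⟩)
    refine Summable.of_nonneg_of_le (fun n => tsum_nonneg fun _ => norm_nonneg _) (fun n => ?_) hs
    exact Real.tsum_le_of_sum_le (fun _ => norm_nonneg _)
      (sum_norm_inner_mul_inner_le b (x n) (y n))
  have h1 : HasSum (fun n => inner ℂ (y n) (x n)) (∑' p, F p) :=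
    hsum.hasSum.prod_fiberwise fun n => b.hasSum_inner_mul_inner (y n) (x n)
  have hsw : HasSum (fun p : ι × ℕ => F (p.2, p.1)) (∑' p, F p) :=
    (Equiv.prodComm ι ℕ).hasSum_iff.2 hsum.hasSum
  have h2 : HasSum (fun i => inner ℂ (b i) (T (b i))) (∑' p, F p) := by
    refine hsw.prod_fiberwise fun i => ?_
    have := (hT (b i)).mapL (innerSL ℂ (b i))
    simpa [hF, inner_smul_right] using this
  rw [h1.tsum_eq]
  exact h2

end TraceClass

section Trace

variable {H : Type*} [NormedAddCommGroup H] [InnerProductSpace ℂ H] [CompleteSpace H]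

/-- The trace `∑ᵢ ⟪bᵢ, T bᵢ⟫` of a trace class operator, computed in some Hilbert basis. By
`IsTraceClass.hasSum_opTrace`, every Hilbert basis gives the same value. -/
def opTrace (T : H →L[ℂ] H) : ℂ :=
  ∑' i, inner ℂ ((exists_hilbertBasis ℂ H).choose_spec.choose i)
    (T ((exists_hilbertBasis ℂ H).choose_spec.choose i))

/-- The trace of a trace class operator does not depend on the Hilbert basis. -/
theorem IsTraceClass.hasSum_opTrace {T : H →L[ℂ] H} (hT : IsTraceClass T)
    {ι : Type*} (b : HilbertBasis ι ℂ H) :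
    HasSum (fun i => inner ℂ (b i) (T (b i))) (opTrace T) := by
  obtain ⟨x, y, hs, hxy⟩ := hT
  have h := hasSum_trace_of_nuclear hs hxy (exists_hilbertBasis ℂ H).choose_spec.choose
  have h' := hasSum_trace_of_nuclear hs hxy b
  rw [opTrace, h.tsum_eq]
  exact h'

/-- The term `(-1)^l i^(l+1) κ^l / l · tr (T^l)`, for `l ≥ 1`. -/
def alphaTerm (κ : ℝ) (T : H →L[ℂ] H) (l : ℕ) : ℂ :=
  (-1) ^ l * Complex.I ^ (l + 1) * (κ : ℂ) ^ l / (l : ℂ) * opTrace (T ^ l)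

/-- `Re ∑_{l ≥ 1} (-1)^l i^(l+1) κ^l / l · tr (T^l)`. -/
def alphaOfOp (κ : ℝ) (T : H →L[ℂ] H) : ℝ :=
  (∑' l : ℕ, alphaTerm κ T (l + 1)).re

/-- The series `∑_{l ≥ 1} (-1)^l i^(l+1) κ^l / l · tr (T^l)` converges geometrically with
ratio `r`: each trace is the trace of a trace class operator, and the terms are
bounded by `M r^l` for some constant `M`. -/
def AlphaSeriesConvergesGeometrically (κ : ℝ) (T : H →L[ℂ] H) (r : ℝ) : Prop :=
  (∀ l : ℕ, 1 ≤ l → IsTraceClass (T ^ l)) ∧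
    ∃ M : ℝ, ∀ l : ℕ, 1 ≤ l → ‖alphaTerm κ T l‖ ≤ M * r ^ l

end Trace

/-! ## Multiplication operators on `L²` -/

/-- Multiplication by an essentially bounded function, as a bounded operator on `L²(μ)`. -/
def mulOp {X : Type*} [MeasurableSpace X] {μ : Measure X} (g : X → ℂ) (hg : MemLp g ∞ μ) :
    Lp ℂ 2 μ →L[ℂ] Lp ℂ 2 μ :=
  (ContinuousLinearMap.mul ℂ ℂ).holderL μ ∞ 2 2 (hg.toLp g)

theorem coeFn_mulOp {X : Type*} [MeasurableSpace X] {μ : Measure X} (g : X → ℂ)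
    (hg : MemLp g ∞ μ) (f : Lp ℂ 2 μ) : mulOp g hg f =ᵐ[μ] fun x => g x * f x := by
  have h1 := (ContinuousLinearMap.mul ℂ ℂ).coeFn_holder (r := 2) (hg.toLp g) f
  filter_upwards [h1, hg.coeFn_toLp] with x hx hy
  rw [← hy]
  exact hx

theorem norm_resolvent_symbol_le {κ : ℝ} (hκ : 0 < κ) (t : ℝ) :
    ‖((κ : ℂ) + Complex.I * (t : ℂ))⁻¹‖ ≤ κ⁻¹ := by
  rw [norm_inv]
  refine inv_anti₀ hκ ?_
  have h := Complex.abs_re_le_norm ((κ : ℂ) + Complex.I * (t : ℂ))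
  simp only [Complex.add_re, Complex.ofReal_re, Complex.mul_re, Complex.I_re, zero_mul,
    Complex.I_im, Complex.ofReal_im, mul_zero, sub_zero, add_zero, abs_of_pos hκ] at h
  exact h

/-! ## The line -/

namespace Line

/-- The Hilbert space `L²(ℝ; ℂ)`. -/
abbrev L2 : Type := Lp ℂ 2 (volume : Measure ℝ)

theorem memLp_symbol {κ : ℝ} (hκ : 0 < κ) (σ : ℝ) :
    MemLp (fun ξ : ℝ => ((κ : ℂ) + Complex.I * ((σ * (2 * Real.pi * ξ) : ℝ) : ℂ))⁻¹) ∞ volume := by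
  refine memLp_top_of_bound (Measurable.aestronglyMeasurable (by fun_prop)) κ⁻¹ ?_
  exact Filter.Eventually.of_forall fun ξ => norm_resolvent_symbol_le hκ _

/-- The bounded inverse `(κ + σ ∂)⁻¹` on `L²(ℝ)`, `κ > 0`, as a Fourier multiplier. With the
normalization `𝓕 f ξ = ∫ f x e^{-2 π i x ξ} dx`, the symbol of `∂` is `2 π i ξ`. -/
def resolvent (κ : ℝ) (hκ : 0 < κ) (σ : ℝ) : L2 →L[ℂ] L2 :=
  ((Lp.fourierTransformₗᵢ ℝ ℂ).symm.toContinuousLinearEquiv : L2 →L[ℂ] L2) ∘L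
    mulOp (fun ξ : ℝ => ((κ : ℂ) + Complex.I * ((σ * (2 * Real.pi * ξ) : ℝ) : ℂ))⁻¹)
      (memLp_symbol hκ σ) ∘L
    ((Lp.fourierTransformₗᵢ ℝ ℂ).toContinuousLinearEquiv : L2 →L[ℂ] L2)

/-- `(κ - ∂)⁻¹ q (κ + ∂)⁻¹ q̄` on `L²(ℝ)`. -/
def laxOp (κ : ℝ) (hκ : 0 < κ) (q : 𝓢(ℝ, ℂ)) : L2 →L[ℂ] L2 :=
  resolvent κ hκ (-1) ∘L mulOp q q.memLp_top ∘L
    resolvent κ hκ 1 ∘L mulOp (star ⇑q) q.memLp_top.star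

/-- `α(κ; q)` on the line. -/
def alpha (κ : ℝ) (hκ : 0 < κ) (q : 𝓢(ℝ, ℂ)) : ℝ := alphaOfOp κ (laxOp κ hκ q)

/-- `‖q‖_{L²} = (∫ |q|² dx)^{1/2}`. -/
def l2Norm (q : 𝓢(ℝ, ℂ)) : ℝ := √(∫ x, ‖q x‖ ^ 2)

/-- `‖q‖_{H^s} = (∫ (1 + ξ²)^s |q̂(ξ)|² dξ)^{1/2}` for the unitary Fourier transform
`q̂(ξ) = (2π)^{-1/2} ∫ q(x) e^{-i x ξ} dx`, written in the variable `ξ / 2π`. -/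
def sobolevNorm (s : ℝ) (q : 𝓢(ℝ, ℂ)) : ℝ :=
  √(∫ ξ : ℝ, (1 + (2 * Real.pi * ξ) ^ 2) ^ s * ‖𝓕 q ξ‖ ^ 2)

end Line

/-! ## The circle `ℝ / 2πℤ` -/

namespace Torus

instance factTwoPiPos : Fact (0 < 2 * Real.pi) := ⟨Real.two_pi_pos⟩

/-- The circle `ℝ / 2πℤ`. -/
abbrev T : Type := AddCircle (2 * Real.pi)

/-- The Hilbert space `L²(ℝ / 2πℤ; ℂ)`. Its measure is `dx / 2π`; bounded operators and their
traces are the same as for `dx`. -/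
abbrev L2 : Type := Lp ℂ 2 (AddCircle.haarAddCircle : Measure T)

theorem norm_symbol_smul_id_le {κ : ℝ} (hκ : 0 < κ) (σ : ℝ) (n : ℤ) :
    ‖((κ : ℂ) + Complex.I * ((σ * n : ℝ) : ℂ))⁻¹ • ContinuousLinearMap.id ℂ ℂ‖ ≤ κ⁻¹ := by
  rw [norm_smul, ContinuousLinearMap.norm_id, mul_one]
  exact norm_resolvent_symbol_le hκ _

/-- The bounded inverse `(κ + σ ∂)⁻¹` on `L²(ℝ / 2πℤ)`, `κ > 0`: it multiplies the `n`-th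
Fourier coefficient by `(κ + i σ n)⁻¹`. -/
def resolvent (κ : ℝ) (hκ : 0 < κ) (σ : ℝ) : L2 →L[ℂ] L2 :=
  ((fourierBasis (T := 2 * Real.pi)).repr.symm.toContinuousLinearEquiv :
      lp (fun _ : ℤ => ℂ) 2 →L[ℂ] L2) ∘L
    lp.mapCLM 2
      (fun n : ℤ => ((κ : ℂ) + Complex.I * ((σ * n : ℝ) : ℂ))⁻¹ • ContinuousLinearMap.id ℂ ℂ)
      (inv_nonneg.2 hκ.le) (norm_symbol_smul_id_le hκ σ) ∘L
    ((fourierBasis (T := 2 * Real.pi)).repr.toContinuousLinearEquiv :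
      L2 →L[ℂ] lp (fun _ : ℤ => ℂ) 2)

theorem memLp_top (q : C(T, ℂ)) : MemLp q ∞ (AddCircle.haarAddCircle : Measure T) :=
  memLp_top_of_bound q.continuous.aestronglyMeasurable ‖q‖
    (Filter.Eventually.of_forall q.norm_coe_le_norm)

/-- `(κ - ∂)⁻¹ q (κ + ∂)⁻¹ q̄` on `L²(ℝ / 2πℤ)`. -/
def laxOp (κ : ℝ) (hκ : 0 < κ) (q : C(T, ℂ)) : L2 →L[ℂ] L2 :=
  resolvent κ hκ (-1) ∘L mulOp q (memLp_top q) ∘L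
    resolvent κ hκ 1 ∘L mulOp (star ⇑q) (memLp_top q).star

/-- `α(κ; q)` on the circle. -/
def alpha (κ : ℝ) (hκ : 0 < κ) (q : C(T, ℂ)) : ℝ := alphaOfOp κ (laxOp κ hκ q)

/-- `‖q‖_{L²} = (∫_0^{2π} |q|² dx)^{1/2}`. -/
def l2Norm (q : C(T, ℂ)) : ℝ := √(∫ x in (0 : ℝ)..2 * Real.pi, ‖q (x : T)‖ ^ 2)

/-- `‖q‖_{H^s} = (∑ₙ (1 + n²)^s |q̂(n)|²)^{1/2}` with
`q̂(n) = (2π)^{-1/2} ∫_0^{2π} q(x) e^{-i n x} dx`; Mathlib's `fourierCoeff q n` is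
`(2π)^{-1/2} q̂(n)`. -/
def sobolevNorm (s : ℝ) (q : C(T, ℂ)) : ℝ :=
  √(∑' n : ℤ, (1 + (n : ℝ) ^ 2) ^ s * (2 * Real.pi * ‖fourierCoeff q n‖ ^ 2))

/-- `q` is a smooth function on the circle. -/
def IsSmooth (q : C(T, ℂ)) : Prop := ContDiff ℝ ∞ fun x : ℝ => q (x : T)

end Torus

end

/-! Write T = AB with A = (κ-∂)⁻¹q and B = (κ+∂)⁻¹q̄. The resolvent symbols are square integrable in
frequency, with L² norm of order κ^(-1/2), so each resolvent has a kernel of that size in L² of its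
second variable, uniformly in the first. Since q is in L², this makes A and B Hilbert–Schmidt. Hence
every T^l is trace class, with |tr T^l| ≤ ‖T‖^(l-1) c for a constant c that may depend on κ and q
(`trace_pow_of_hilbertSchmidt`). Everything reduces to the operator bound κ‖T‖ ≤ 1/2, which gives
ratio 1/2 in all four cases.

That bound is estimated on the adjoints q̄(κ+∂)⁻¹ and q(κ-∂)⁻¹. The kernel sends L² into L^∞, so
each has norm at most a multiple of κ^(-1/2)‖q‖₂, which settles small mass. For large κ, split q = g
+ h at frequency κ. By Cauchy–Schwarz the low part satisfies ‖g‖_∞ ≲ κ^(1/2-a)‖q‖_{H^s} and is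
paired with the resolvent bound κ⁻¹. The high part satisfies ‖h‖₂ ≲ κ^(-a)‖q‖_{H^s} and is paired
with the kernel bound. Both contributions are of size κ^(-1/2-a)‖q‖_{H^s}, so κ‖T‖ ≲
(κ^(-a)‖q‖_{H^s})².

The abstract half of the argument is `alphaSeriesConvergesGeometrically_of_split`. The line and the
circle supply the kernel bound and the splitting. On the circle integrals become lattice sums, and
the lower bound κ₀ is needed to absorb the zero mode. -/

noncomputable section

/-! ## Traces of nuclear operators -/

section Trace

variable {H : Type*} [NormedAddCommGroup H] [InnerProductSpace ℂ H]

/-- The Hilbert–Schmidt norm of an operator is at most that of its adjoint. -/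
theorem sum_norm_sq_le_of_adjoint {ι : Type*} (b : HilbertBasis ι ℂ H) {A A' : H →L[ℂ] H}
    (hA : ∀ u v, inner ℂ (A' u) v = inner ℂ u (A v)) {c : ℝ}
    (hc : ∀ s : Finset ι, ∑ i ∈ s, ‖A' (b i)‖ ^ 2 ≤ c) (s : Finset ι) :
    ∑ i ∈ s, ‖A (b i)‖ ^ 2 ≤ c := by
  have parseval : ∀ v : H, HasSum (fun j => ‖inner ℂ (b j) v‖ ^ 2) (‖v‖ ^ 2) := fun v => by
    have := lp.hasSum_norm (p := 2) (by norm_num) (b.repr v)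
    simpa [b.repr_apply_apply] using this
  -- Parseval in j turns the sum into a sum of squared matrix entries; exchanging the two sums and
  -- applying Bessel in i brings back the adjoint.
  have h1 : HasSum (fun j => ∑ i ∈ s, ‖inner ℂ (b j) (A (b i))‖ ^ 2)
      (∑ i ∈ s, ‖A (b i)‖ ^ 2) := hasSum_sum fun i _ => parseval _
  refine hasSum_le_of_sum_le h1 fun t => le_trans (Finset.sum_le_sum fun j _ => ?_) (hc t)
  simp only [← hA]
  calc ∑ i ∈ s, ‖inner ℂ (A' (b j)) (b i)‖ ^ 2 = ∑ i ∈ s, ‖inner ℂ (b i) (A' (b j))‖ ^ 2 :=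
        Finset.sum_congr rfl fun i _ => by rw [norm_inner_symm]
    _ ≤ ‖A' (b j)‖ ^ 2 := b.orthonormal.sum_inner_products_le _

variable [CompleteSpace H]

/-- The space need not be separable, so a basis may be uncountable, while `IsTraceClass` asks for
sequences. Summability leaves only countably many nonzero terms; these are injected into ℕ and
extended by zero. The trace is then the sum of ⟪yₙ, xₙ⟫, and Cauchy–Schwarz bounds it. -/
theorem isTraceClass_and_norm_opTrace_le {ι : Type*} {T : H →L[ℂ] H} {x y : ι → H}
    (hs : Summable (fun i => ‖x i‖ * ‖y i‖))
    (hT : ∀ v, HasSum (fun i => inner ℂ (y i) v • x i) (T v)) :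
    IsTraceClass T ∧ ‖opTrace T‖ ≤ ∑' i, ‖x i‖ * ‖y i‖ := by
  set S : Set ι := Function.support (fun i => ‖x i‖ * ‖y i‖) with hS
  have hc : Countable S := hs.countable_support.to_subtype
  obtain ⟨e, he⟩ := hc.exists_injective_nat
  set x' : ℕ → H := Function.extend e (fun i : S => x i) 0
  set y' : ℕ → H := Function.extend e (fun i : S => y i) 0
  have hx' : ∀ i : S, x' (e i) = x i := fun i => he.extend_apply _ _ i
  have hy' : ∀ i : S, y' (e i) = y i := fun i => he.extend_apply _ _ i
  have hx0 : ∀ n, n ∉ Set.range e → x' n = 0 := fun n hn =>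
    Function.extend_apply' _ _ n (by simpa using hn)
  have hn : HasSum (fun n => ‖x' n‖ * ‖y' n‖) (∑' i, ‖x i‖ * ‖y i‖) := by
    rw [← he.hasSum_iff (fun n hn => by simp [hx0 n hn])]
    have := (hasSum_subtype_iff_of_support_subset (s := S) subset_rfl).2 hs.hasSum
    convert this using 1
    ext i
    simp [hx', hy']
  have hT' : ∀ v, HasSum (fun n => inner ℂ (y' n) v • x' n) (T v) := fun v => by
    rw [← he.hasSum_iff (fun n hn => by simp [hx0 n hn])]
    have := (hasSum_subtype_iff_of_support_subset (s := S) (fun i hi => ?_)).2 (hT v)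
    · convert this using 1
      ext i
      simp [hx', hy']
    · rw [hS, Function.mem_support]
      contrapose! hi
      rcases mul_eq_zero.1 hi with h | h
      · simp [norm_eq_zero.1 h]
      · simp [norm_eq_zero.1 h]
  refine ⟨⟨x', y', hn.summable, hT'⟩, ?_⟩
  have htr := hasSum_trace_of_nuclear hn.summable hT'
    (exists_hilbertBasis ℂ H).choose_spec.choose
  rw [opTrace, htr.tsum_eq, ← hn.tsum_eq]
  have hle : ∀ n, ‖inner ℂ (y' n) (x' n)‖ ≤ ‖x' n‖ * ‖y' n‖ := fun n =>
    (norm_inner_le_norm _ _).trans_eq (mul_comm _ _)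
  exact tsum_of_norm_bounded hn hle |>.trans_eq hn.tsum_eq.symm

/-- Powers of a product of two Hilbert–Schmidt operators are trace class. Here `B'` is the
adjoint of `B`. -/
theorem trace_pow_of_hilbertSchmidt {ι : Type*} (b : HilbertBasis ι ℂ H)
    {A B B' : H →L[ℂ] H} (hB : ∀ u v, inner ℂ (B' u) v = inner ℂ u (B v)) {c : ℝ}
    (hAc : ∀ s : Finset ι, ∑ i ∈ s, ‖A (b i)‖ ^ 2 ≤ c)
    (hBc : ∀ s : Finset ι, ∑ i ∈ s, ‖B' (b i)‖ ^ 2 ≤ c) (l : ℕ) :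
    IsTraceClass ((A ∘L B) ^ (l + 1)) ∧ ‖opTrace ((A ∘L B) ^ (l + 1))‖ ≤ ‖A ∘L B‖ ^ l * c := by
  set T := A ∘L B
  have hbound : ∀ i, ‖(T ^ l) (A (b i))‖ * ‖B' (b i)‖ ≤
      ‖T‖ ^ l * ((‖A (b i)‖ ^ 2 + ‖B' (b i)‖ ^ 2) / 2) := fun i => by
    have h1 : ‖(T ^ l) (A (b i))‖ ≤ ‖T‖ ^ l * ‖A (b i)‖ := by
      refine ((T ^ l).le_opNorm _).trans ?_
      gcongr
      -- On the zero space the identity has norm 0 rather than 1, so exponent 0 only gives an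
      -- inequality and is treated apart.
      cases l with
      | zero =>
        rw [pow_zero, pow_zero]
        exact ContinuousLinearMap.norm_id_le
      | succ l => exact norm_pow_le' T l.succ_pos
    calc _ ≤ ‖T‖ ^ l * ‖A (b i)‖ * ‖B' (b i)‖ := by gcongr
      _ = ‖T‖ ^ l * (‖A (b i)‖ * ‖B' (b i)‖) := by ring
      _ ≤ _ := by
        gcongr
        nlinarith [sq_nonneg (‖A (b i)‖ - ‖B' (b i)‖)]
  have hsum : ∀ s : Finset ι, ∑ i ∈ s, ‖(T ^ l) (A (b i))‖ * ‖B' (b i)‖ ≤ ‖T‖ ^ l * c :=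
    fun s => by
    refine (Finset.sum_le_sum fun i _ => hbound i).trans ?_
    rw [← Finset.mul_sum, ← Finset.sum_div, Finset.sum_add_distrib]
    gcongr
    linarith [hAc s, hBc s]
  have hnn : ∀ i, 0 ≤ ‖(T ^ l) (A (b i))‖ * ‖B' (b i)‖ := fun i => by positivity
  have hs := summable_of_sum_le hnn hsum
  -- Expanding B v in the basis before applying T^l A exhibits the nuclear decomposition.
  have hT : ∀ v, HasSum (fun i => inner ℂ (B' (b i)) v • (T ^ l) (A (b i)))
      ((T ^ (l + 1)) v) := fun v => by
    have h := ((T ^ l) ∘L A).hasSum (b.hasSum_repr (B v))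
    have hv : (T ^ (l + 1)) v = ((T ^ l) ∘L A) (B v) := by
      rw [pow_succ]; rfl
    rw [hv]
    convert h using 1
    ext i
    rw [hB, b.repr_apply_apply, map_smul]
    rfl
  obtain ⟨h1, h2⟩ := isTraceClass_and_norm_opTrace_le hs hT
  exact ⟨h1, h2.trans (Real.tsum_le_of_sum_le hnn hsum)⟩

theorem alphaSeriesConvergesGeometrically_half {κ : ℝ} (hκ : 0 < κ) {T : H →L[ℂ] H} {c : ℝ}
    (hT : ∀ l : ℕ, IsTraceClass (T ^ (l + 1)) ∧ ‖opTrace (T ^ (l + 1))‖ ≤ ‖T‖ ^ l * c)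
    (hsmall : κ * ‖T‖ ≤ 1 / 2) : AlphaSeriesConvergesGeometrically κ T (1 / 2) := by
  have hc : 0 ≤ c := by simpa using (norm_nonneg _).trans (hT 0).2
  -- The trace bound for T^l contains only l - 1 factors ‖T‖: one κ is left over, and the 2 restores
  -- the missing factor 1/2.
  refine ⟨fun l hl => ?_, 2 * κ * c, fun l hl => ?_⟩
  · obtain ⟨k, rfl⟩ := Nat.exists_eq_add_of_le' hl
    exact (hT k).1
  · obtain ⟨k, rfl⟩ := Nat.exists_eq_add_of_le' hl
    have h1 : (1 : ℝ) ≤ ((k + 1 : ℕ) : ℝ) := by simp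
    calc ‖alphaTerm κ T (k + 1)‖
        = κ ^ (k + 1) / ((k + 1 : ℕ) : ℝ) * ‖opTrace (T ^ (k + 1))‖ := by
          simp only [alphaTerm, norm_mul, norm_div, norm_pow, norm_neg, norm_one, one_pow,
            Complex.norm_I, one_mul, Complex.norm_real, Complex.norm_natCast, Real.norm_eq_abs,
            abs_of_pos hκ]
      _ ≤ κ ^ (k + 1) * (‖T‖ ^ k * c) := by
          gcongr
          · exact div_le_self (by positivity) h1
          · exact (hT k).2
      _ = κ * c * (κ * ‖T‖) ^ k := by ring
      _ ≤ κ * c * (1 / 2) ^ k := by gcongr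
      _ = 2 * κ * c * (1 / 2) ^ (k + 1) := by ring

/-- `alphaOfOp` is built on `tsum`, which is 0 for a divergent series. The geometric bound shows
that it is the genuine sum, so the real part may be taken term by term. -/
theorem AlphaSeriesConvergesGeometrically.hasSum_re {κ r : ℝ} (hr : 0 ≤ r) (hr1 : r < 1)
    {T : H →L[ℂ] H} (h : AlphaSeriesConvergesGeometrically κ T r) :
    HasSum (fun l : ℕ => (alphaTerm κ T (l + 1)).re) (alphaOfOp κ T) := by
  obtain ⟨-, M, hM⟩ := h
  have hg : Summable fun l : ℕ => M * r ^ (l + 1) :=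
    ((summable_nat_add_iff 1).2 (summable_geometric_of_lt_one hr hr1)).mul_left M
  have hs : Summable fun l : ℕ => alphaTerm κ T (l + 1) :=
    Summable.of_norm_bounded hg fun l => hM (l + 1) (Nat.le_add_left 1 l)
  exact Complex.hasSum_re hs.hasSum

end Trace

/-! ## Multiplication operators composed with smoothing operators -/

section Kernel

variable {X : Type*} [MeasurableSpace X] {μ : Measure X}

theorem norm_sq_eq_integral_norm_sq (f : Lp ℂ 2 μ) : ‖f‖ ^ 2 = ∫ x, ‖f x‖ ^ 2 ∂μ := by
  have h := congr_arg RCLike.re (L2.inner_def (𝕜 := ℂ) f f)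
  rw [← integral_re (L2.integrable_inner f f)] at h
  simp only [← norm_sq_eq_re_inner] at h
  exact h

theorem inner_mulOp_star (g : X → ℂ) (hg : MemLp g ∞ μ) (u v : Lp ℂ 2 μ) :
    inner ℂ (mulOp (star g) hg.star u) v = inner ℂ u (mulOp g hg v) := by
  rw [L2.inner_def, L2.inner_def]
  refine integral_congr_ae ?_
  filter_upwards [coeFn_mulOp (star g) hg.star u, coeFn_mulOp g hg v] with x h1 h2
  rw [h1, h2]
  simp only [RCLike.inner_apply', Pi.star_apply, RCLike.star_def, map_mul, RCLike.conj_conj]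
  ring

theorem norm_mulOp_star (g : X → ℂ) (hg : MemLp g ∞ μ) (u : Lp ℂ 2 μ) :
    ‖mulOp (star g) hg.star u‖ = ‖mulOp g hg u‖ := by
  refine le_antisymm (Lp.norm_le_norm_of_ae_le ?_) (Lp.norm_le_norm_of_ae_le ?_) <;>
  filter_upwards [coeFn_mulOp (star g) hg.star u, coeFn_mulOp g hg u] with x h1 h2 <;>
  simp [h1, h2]

theorem norm_mulOp_apply_le {g : X → ℂ} (hg : MemLp g ∞ μ) {L : ℝ}
    (hL : ∀ᵐ x ∂μ, ‖g x‖ ≤ L) (u : Lp ℂ 2 μ) : ‖mulOp g hg u‖ ≤ L * ‖u‖ := by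
  refine Lp.norm_le_mul_norm_of_ae_le_mul ?_
  filter_upwards [coeFn_mulOp g hg u, hL] with x h1 h2
  rw [h1, norm_mul]
  gcongr

/-- `R` is an integral operator on `L²(μ)` whose kernel has `L²` norm at most `K` in its
second variable. -/
def HasBoundedKernel (R : Lp ℂ 2 μ →L[ℂ] Lp ℂ 2 μ) (K : ℝ) : Prop :=
  ∃ k : X → Lp ℂ 2 μ, (∀ x, ‖k x‖ ≤ K) ∧ ∀ f, ∀ᵐ x ∂μ, R f x = inner ℂ (k x) f

/-- Cauchy–Schwarz against the kernel gives |R f| ≤ K‖f‖ almost everywhere, and multiplication by a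
square integrable function returns from L^∞ to L². -/
theorem HasBoundedKernel.norm_mulOp_le {R : Lp ℂ 2 μ →L[ℂ] Lp ℂ 2 μ} {K : ℝ}
    (hR : HasBoundedKernel R K) {g : X → ℂ} (hg : MemLp g ∞ μ) (hg2 : MemLp g 2 μ)
    (f : Lp ℂ 2 μ) : ‖mulOp g hg (R f)‖ ≤ K * √(∫ x, ‖g x‖ ^ 2 ∂μ) * ‖f‖ := by
  obtain ⟨k, hk, hkf⟩ := hR
  -- The sign of K can only be read off from a point of X; without points the measure vanishes.
  have hK : 0 ≤ K ∨ μ = 0 := by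
    rcases isEmpty_or_nonempty X with h | ⟨⟨x⟩⟩
    · right; exact Measure.eq_zero_of_isEmpty μ
    · left; exact (norm_nonneg _).trans (hk x)
  rcases hK with hK | rfl
  · refine le_of_sq_le_sq ?_ (by positivity)
    rw [mul_pow, mul_pow, Real.sq_sqrt (integral_nonneg fun x => by positivity),
      norm_sq_eq_integral_norm_sq, mul_right_comm, ← integral_const_mul]
    refine integral_mono_of_nonneg (Filter.Eventually.of_forall fun x => by positivity)
      ((hg2.integrable_norm_pow (by norm_num)).const_mul _) ?_
    filter_upwards [coeFn_mulOp g hg (R f), hkf f] with x h1 h2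
    have h3 : ‖R f x‖ ≤ K * ‖f‖ := by
      rw [h2]
      exact (norm_inner_le_norm _ _).trans (by gcongr; exact hk x)
    calc ‖mulOp g hg (R f) x‖ ^ 2 = ‖R f x‖ ^ 2 * ‖g x‖ ^ 2 := by
          rw [h1, norm_mul, mul_pow, mul_comm]
      _ ≤ (K * ‖f‖) ^ 2 * ‖g x‖ ^ 2 := by gcongr
      _ = K ^ 2 * ‖f‖ ^ 2 * ‖g x‖ ^ 2 := by rw [mul_pow]
  · have : ∀ u : Lp ℂ 2 (0 : Measure X), ‖u‖ = 0 := fun u => by simp [Lp.norm_def]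
    simp [this]

/-- The Hilbert–Schmidt bound: for almost every x, Bessel's inequality for the kernel vector k x
bounds the sum over the basis by K², and this is integrated against |g|². -/
theorem HasBoundedKernel.sum_norm_sq_mulOp_le {R : Lp ℂ 2 μ →L[ℂ] Lp ℂ 2 μ} {K : ℝ}
    (hR : HasBoundedKernel R K) {g : X → ℂ} (hg : MemLp g ∞ μ) (hg2 : MemLp g 2 μ)
    {ι : Type*} (b : HilbertBasis ι ℂ (Lp ℂ 2 μ)) (s : Finset ι) :
    ∑ i ∈ s, ‖mulOp g hg (R (b i))‖ ^ 2 ≤ K ^ 2 * ∫ x, ‖g x‖ ^ 2 ∂μ := by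
  obtain ⟨k, hk, hkf⟩ := hR
  have hint : ∀ f : Lp ℂ 2 μ, Integrable (fun x => ‖f x‖ ^ 2) μ := fun f =>
    (Lp.memLp f).integrable_norm_pow (by norm_num)
  simp_rw [norm_sq_eq_integral_norm_sq]
  rw [← integral_finsetSum s fun i _ => hint _, ← integral_const_mul]
  refine integral_mono_ae (integrable_finsetSum s fun i _ => hint _)
    ((hg2.integrable_norm_pow (by norm_num)).const_mul _) ?_
  have h1 : ∀ᵐ x ∂μ, ∀ i ∈ s, mulOp g hg (R (b i)) x = g x * inner ℂ (k x) (b i) := by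
    refine (Filter.eventually_all_finset s).2 fun i _ => ?_
    filter_upwards [coeFn_mulOp g hg (R (b i)), hkf (b i)] with x h1 h2
    rw [h1, h2]
  filter_upwards [h1] with x hx
  calc ∑ i ∈ s, ‖mulOp g hg (R (b i)) x‖ ^ 2
      = ‖g x‖ ^ 2 * ∑ i ∈ s, ‖inner ℂ (b i) (k x)‖ ^ 2 := by
        rw [Finset.mul_sum]
        refine Finset.sum_congr rfl fun i hi => ?_
        rw [hx i hi, norm_mul, mul_pow, norm_inner_symm]
    _ ≤ ‖g x‖ ^ 2 * K ^ 2 := by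
        gcongr
        exact (b.orthonormal.sum_inner_products_le _).trans (by gcongr; exact hk x)
    _ = _ := mul_comm _ _

/-- If `R` is bounded by `κ⁻¹` and has a bounded kernel, then a splitting `q = g + h` into a
bounded and a square integrable part bounds the operator `q R`. -/
theorem HasBoundedKernel.norm_mulOp_le_of_split {R : Lp ℂ 2 μ →L[ℂ] Lp ℂ 2 μ} {K κ : ℝ}
    (hR : HasBoundedKernel R K) (hRκ : ∀ f, ‖R f‖ ≤ κ⁻¹ * ‖f‖)
    {q g h : X → ℂ} (hq : MemLp q ∞ μ) (hg : MemLp g ∞ μ) (hh : MemLp h ∞ μ) (hh2 : MemLp h 2 μ)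
    (hsplit : q =ᵐ[μ] g + h) {L : ℝ} (hL : ∀ᵐ x ∂μ, ‖g x‖ ≤ L) (hL0 : 0 ≤ L) (f : Lp ℂ 2 μ) :
    ‖mulOp q hq (R f)‖ ≤ (L * κ⁻¹ + K * √(∫ x, ‖h x‖ ^ 2 ∂μ)) * ‖f‖ := by
  have hadd : mulOp q hq (R f) = mulOp g hg (R f) + mulOp h hh (R f) := by
    refine Lp.ext ?_
    filter_upwards [coeFn_mulOp q hq (R f), coeFn_mulOp g hg (R f), coeFn_mulOp h hh (R f),
      Lp.coeFn_add (mulOp g hg (R f)) (mulOp h hh (R f)), hsplit] with x h1 h2 h3 h4 h5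
    rw [h4, Pi.add_apply, h1, h2, h3, h5, Pi.add_apply, add_mul]
  rw [hadd, add_mul]
  refine (norm_add_le _ _).trans (add_le_add ?_ (hR.norm_mulOp_le hh hh2 f))
  refine (norm_mulOp_apply_le hg hL _).trans ?_
  rw [mul_assoc]
  exact mul_le_mul_of_nonneg_left (hRκ f) hL0

/-- Follows from ‖A v‖² = ⟪A' A v, v⟫. It is needed because the kernel estimates treat
multiplication after the resolvent, while the factors of T multiply before it. -/
theorem norm_le_of_inner_adjoint {H : Type*} [NormedAddCommGroup H] [InnerProductSpace ℂ H]
    {A A' : H →L[ℂ] H} (hA : ∀ u v, inner ℂ (A' u) v = inner ℂ u (A v)) {β : ℝ}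
    (hβ : 0 ≤ β) (h : ∀ f, ‖A' f‖ ≤ β * ‖f‖) : ‖A‖ ≤ β := by
  refine A.opNorm_le_bound hβ fun v => ?_
  have h1 : ‖A v‖ ^ 2 ≤ β * ‖A v‖ * ‖v‖ := by
    calc ‖A v‖ ^ 2 = ‖inner ℂ (A' (A v)) v‖ := by
          rw [hA, inner_self_eq_norm_sq_to_K]; simp
      _ ≤ ‖A' (A v)‖ * ‖v‖ := norm_inner_le_norm _ _
      _ ≤ _ := by gcongr; exact h _
  rcases (norm_nonneg (A v)).eq_or_lt' with h0 | h0
  · rw [h0]; positivity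
  · refine le_of_mul_le_mul_right ?_ h0
    linarith [h1, sq (‖A v‖)]

/-- Abstract convergence criterion for `R₋ q R₊ q̄`, where `R₋` and `R₊` are adjoint to each
other. -/
theorem alphaSeriesConvergesGeometrically_of_split {Rm Rp : Lp ℂ 2 μ →L[ℂ] Lp ℂ 2 μ} {K κ : ℝ}
    (hκ : 0 < κ) (hK : 0 ≤ K) (hadj : ∀ u v, inner ℂ (Rp u) v = inner ℂ u (Rm v))
    (hm : HasBoundedKernel Rm K) (hp : HasBoundedKernel Rp K)
    (hmκ : ∀ f, ‖Rm f‖ ≤ κ⁻¹ * ‖f‖) (hpκ : ∀ f, ‖Rp f‖ ≤ κ⁻¹ * ‖f‖)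
    {q g h : X → ℂ} (hq : MemLp q ∞ μ) (hq2 : MemLp q 2 μ)
    (hg : MemLp g ∞ μ) (hh : MemLp h ∞ μ) (hh2 : MemLp h 2 μ)
    (hsplit : q =ᵐ[μ] g + h) {L : ℝ} (hL : ∀ᵐ x ∂μ, ‖g x‖ ≤ L) (hL0 : 0 ≤ L)
    (hsmall : κ * (L * κ⁻¹ + K * √(∫ x, ‖h x‖ ^ 2 ∂μ)) ^ 2 ≤ 1 / 2) :
    AlphaSeriesConvergesGeometrically κ
      (Rm ∘L mulOp q hq ∘L Rp ∘L mulOp (star q) hq.star) (1 / 2) := by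
  set β := L * κ⁻¹ + K * √(∫ x, ‖h x‖ ^ 2 ∂μ) with hβdef
  have hβ : 0 ≤ β := by positivity
  set A := Rm ∘L mulOp q hq
  set B := Rp ∘L mulOp (star q) hq.star
  set A' := mulOp (star q) hq.star ∘L Rp
  set B' := mulOp q hq ∘L Rm
  have hadj' : ∀ u v, inner ℂ (Rm u) v = inner ℂ u (Rp v) := fun u v => by
    rw [← inner_conj_symm, ← hadj, inner_conj_symm]
  have hA : ∀ u v, inner ℂ (A' u) v = inner ℂ u (A v) := fun u v =>
    (inner_mulOp_star q hq (Rp u) v).trans (hadj u _)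
  have hB : ∀ u v, inner ℂ (B' u) v = inner ℂ u (B v) := fun u v => by
    have := inner_mulOp_star q hq v (Rm u)
    calc inner ℂ (B' u) v = inner ℂ (Rm u) (mulOp (star q) hq.star v) := by
          rw [← inner_conj_symm, ← inner_conj_symm (Rm u), this]; rfl
      _ = _ := hadj' u _
  have hAn : ‖A‖ ≤ β := norm_le_of_inner_adjoint hA hβ fun f => by
    refine (norm_mulOp_star q hq (Rp f)).trans_le ?_
    exact hp.norm_mulOp_le_of_split hpκ hq hg hh hh2 hsplit hL hL0 f
  have hBn : ‖B‖ ≤ β := norm_le_of_inner_adjoint hB hβ fun f =>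
    hm.norm_mulOp_le_of_split hmκ hq hg hh hh2 hsplit hL hL0 f
  obtain ⟨w, b, -⟩ := exists_hilbertBasis ℂ (Lp ℂ 2 μ)
  -- The Hilbert–Schmidt constant uses all of q and need not be small: it only enters M. Smallness
  -- comes from the operator norms, through the splitting.
  have hBs : ∀ s : Finset w, ∑ i ∈ s, ‖B' (b i)‖ ^ 2 ≤ K ^ 2 * ∫ x, ‖q x‖ ^ 2 ∂μ := fun s =>
    hm.sum_norm_sq_mulOp_le hq hq2 b s
  have hAs : ∀ s : Finset w, ∑ i ∈ s, ‖A (b i)‖ ^ 2 ≤ K ^ 2 * ∫ x, ‖q x‖ ^ 2 ∂μ := fun s =>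
    sum_norm_sq_le_of_adjoint b hA (fun t => by
      have := hp.sum_norm_sq_mulOp_le hq.star hq2.star b t
      simp only [Pi.star_apply, norm_star] at this
      exact this) s
  refine alphaSeriesConvergesGeometrically_half hκ
    (fun l => trace_pow_of_hilbertSchmidt b hB hAs hBs l) (le_trans ?_ hsmall)
  rw [sq]
  gcongr
  exact (ContinuousLinearMap.opNorm_comp_le A B).trans (by gcongr)

end Kernel

/-! ## Sobolev weights -/

/-- The choice of the constant in `C S ^ (1 / a) ≤ κ`. -/
theorem exists_const_of_scaling {a D : ℝ} (ha : 0 < a) (hD : 0 < D) :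
    ∃ C > (0 : ℝ), ∀ κ > (0 : ℝ), ∀ S ≥ (0 : ℝ), C * S ^ (1 / a) ≤ κ →
      κ * (D * κ ^ (-(1 / 2) - a : ℝ) * S) ^ 2 ≤ 1 / 2 := by
  -- With this C the hypothesis reads 2 D S ≤ κ^a, and the quantity to bound is (D S κ^(-a))² ≤ 1/4.
  refine ⟨(2 * D) ^ (1 / a), by positivity, fun κ hκ S hS h => ?_⟩
  have h1 : 2 * D * S ≤ κ ^ a := by
    rw [← Real.mul_rpow (by positivity) hS] at h
    calc 2 * D * S = ((2 * D * S) ^ (1 / a)) ^ a := by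
          rw [← Real.rpow_mul (by positivity), one_div_mul_cancel ha.ne', Real.rpow_one]
      _ ≤ κ ^ a := Real.rpow_le_rpow (by positivity) h ha.le
  have h2 : κ * (D * κ ^ (-(1 / 2) - a : ℝ) * S) ^ 2 = ((D * S) * κ ^ (-a)) ^ 2 := by
    have : κ ^ (-(1 / 2) - a : ℝ) = κ ^ (-a) * κ ^ (-(1 / 2) : ℝ) := by
      rw [← Real.rpow_add hκ]; ring_nf
    have h3 : (κ ^ (-(1 / 2) : ℝ)) ^ 2 = κ⁻¹ := by
      rw [← Real.rpow_natCast, ← Real.rpow_mul hκ.le, ← Real.rpow_neg_one]; norm_num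
    rw [this]
    calc _ = ((D * S) * κ ^ (-a)) ^ 2 * (κ * (κ ^ (-(1 / 2) : ℝ)) ^ 2) := by ring
      _ = _ := by rw [h3, mul_inv_cancel₀ hκ.ne', mul_one]
  have h3 : D * S * κ ^ (-a) ≤ 1 / 2 := by
    rw [Real.rpow_neg hκ.le, ← div_eq_mul_inv, div_le_iff₀ (by positivity)]
    linarith
  rw [h2]
  calc _ ≤ (1 / 2 : ℝ) ^ 2 := by gcongr
    _ ≤ 1 / 2 := by norm_num

/-- Off the frequency ball of radius `κ` the Sobolev weight is at least `κ ^ (2a)`. -/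
theorem rpow_le_sobolev_weight {a s κ t : ℝ} (ha : 0 < a) (has : a ≤ s) (hκ : 0 < κ)
    (ht : κ ≤ |t|) : κ ^ (2 * a) ≤ (1 + t ^ 2) ^ s := by
  calc κ ^ (2 * a) = (κ ^ 2) ^ a := by rw [Real.rpow_mul hκ.le]; norm_num
    _ ≤ (1 + t ^ 2) ^ a := by
        gcongr
        nlinarith [sq_abs t, abs_nonneg t]
    _ ≤ (1 + t ^ 2) ^ s := Real.rpow_le_rpow_of_exponent_le (by nlinarith [sq_nonneg t]) has

theorem sobolev_weight_inv_le {a s t : ℝ} (ha : 0 < a) (has : a ≤ s) (ht : 0 < t) :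
    ((1 + t ^ 2) ^ s)⁻¹ ≤ t ^ (-(2 * a)) := by
  rw [Real.rpow_neg ht.le]
  gcongr
  exact rpow_le_sobolev_weight ha has ht (le_abs_self t)

theorem integral_mul_le_sqrt_mul_sqrt {X : Type*} [MeasurableSpace X] {μ : Measure X}
    {f g : X → ℝ} (hf0 : 0 ≤ f) (hg0 : 0 ≤ g) (hf : MemLp f 2 μ) (hg : MemLp g 2 μ) :
    ∫ x, f x * g x ∂μ ≤ √(∫ x, f x ^ 2 ∂μ) * √(∫ x, g x ^ 2 ∂μ) := by
  have h := integral_mul_le_Lp_mul_Lq_of_nonneg (μ := μ) (p := 2) (q := 2)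
    Real.HolderConjugate.two_two (Filter.Eventually.of_forall hf0)
    (Filter.Eventually.of_forall hg0) (by simpa using hf) (by simpa using hg)
  simpa [Real.sqrt_eq_rpow] using h

/-! ## The line -/

namespace Line

/-- The L² transform has no pointwise formula a priori. Both sides are tested against smooth
compactly supported functions: the left through its tempered distribution, the right by moving the
Fourier integral onto the test function. -/
theorem coeFn_fourierInv_eq_integral {f : L2} (hf : Integrable f) :
    (Lp.fourierTransformₗᵢ ℝ ℂ).symm f =ᵐ[volume] 𝓕⁻ (f : ℝ → ℂ) := by
  refine ae_eq_of_integral_contDiff_smul_eq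
    ((Lp.memLp _).locallyIntegrable (by norm_num)) ?_ fun g hg hgc => ?_
  · have : Continuous (𝓕⁻ (f : ℝ → ℂ)) :=
      VectorFourier.fourierIntegral_continuous Real.continuous_fourierChar
        (by simp; fun_prop) hf
    exact this.locallyIntegrable
  · have hg₁ : HasCompactSupport (Complex.ofRealCLM ∘ g) := hgc.comp_left rfl
    have hg₂ : ContDiff ℝ ∞ (Complex.ofRealCLM ∘ g) := by fun_prop
    set φ : 𝓢(ℝ, ℂ) := hg₁.toSchwartzMap hg₂
    have hφ : ∀ x, φ x = (g x : ℂ) := fun x => rfl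
    have h1 : ∫ x, φ x • ((Lp.fourierTransformₗᵢ ℝ ℂ).symm f) x = ∫ x, (𝓕⁻ φ) x • f x := by
      have h := congr_arg (fun D : 𝓢'(ℝ, ℂ) => D φ) (Lp.fourierInv_toTemperedDistribution_eq f)
      simp only [TemperedDistribution.fourierInv_apply, Lp.toTemperedDistribution_apply] at h
      exact h.symm
    have h2 : ∫ x, (𝓕⁻ φ) x • f x = ∫ x, φ x • 𝓕⁻ (f : ℝ → ℂ) x := by
      have h := VectorFourier.integral_fourierIntegral_smul_eq_flip (L := -innerₗ ℝ)
        (μ := volume) (ν := volume) Real.continuous_fourierChar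
        (by simp; fun_prop) φ.integrable hf
      have hflip : (-innerₗ ℝ).flip = -innerₗ ℝ := by
        ext; simp
      rw [hflip] at h
      rw [SchwartzMap.fourierInv_coe]
      exact h
    simpa [hφ] using h1.trans h2

/-- The symbol of `(κ + σ ∂)⁻¹`. -/
def symbol (κ σ ξ : ℝ) : ℂ := ((κ : ℂ) + Complex.I * ((σ * (2 * Real.pi * ξ) : ℝ) : ℂ))⁻¹

theorem symbol_neg (κ σ ξ : ℝ) : symbol κ (-σ) ξ = star (symbol κ σ ξ) := by
  simp [symbol, Complex.conj_ofReal]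

theorem norm_symbol_sq (κ σ ξ : ℝ) :
    ‖symbol κ σ ξ‖ ^ 2 = (κ ^ 2 + σ ^ 2 * (2 * Real.pi * ξ) ^ 2)⁻¹ := by
  rw [symbol, norm_inv, inv_pow, ← Complex.normSq_eq_norm_sq, Complex.normSq_apply]
  simp
  ring

theorem continuous_symbol {κ : ℝ} (hκ : 0 < κ) (σ : ℝ) : Continuous (symbol κ σ) := by
  unfold symbol
  refine Continuous.inv₀ (by fun_prop) fun ξ h => hκ.ne' ?_
  simpa using congr_arg Complex.re h

theorem memLp_top_symbol {κ : ℝ} (hκ : 0 < κ) (σ : ℝ) : MemLp (symbol κ σ) ∞ volume :=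
  memLp_symbol hκ σ

/-- Rescaling ξ by 2π/κ reduces this to the integral of 1/(1+x²), which is π. This is the source of
the κ^(-1/2) gain. -/
theorem hasIntegral_norm_symbol_sq {κ : ℝ} (hκ : 0 < κ) {σ : ℝ} (hσ : σ ^ 2 = 1) :
    Integrable (fun ξ => ‖symbol κ σ ξ‖ ^ 2) ∧ ∫ ξ, ‖symbol κ σ ξ‖ ^ 2 = (2 * κ)⁻¹ := by
  have h : ∀ ξ, ‖symbol κ σ ξ‖ ^ 2 = (κ ^ 2)⁻¹ * (1 + (2 * Real.pi / κ * ξ) ^ 2)⁻¹ := fun ξ => by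
    rw [norm_symbol_sq, hσ, ← mul_inv]
    congr 1
    field_simp
  have hc : 2 * Real.pi / κ ≠ 0 := by positivity
  simp_rw [h]
  refine ⟨(integrable_inv_one_add_sq.comp_mul_left' hc).const_mul _, ?_⟩
  rw [integral_const_mul, Measure.integral_comp_mul_left (fun x : ℝ => (1 + x ^ 2)⁻¹),
    integral_univ_inv_one_add_sq, abs_of_pos (by positivity), smul_eq_mul]
  field_simp

theorem resolvent_apply {κ : ℝ} (hκ : 0 < κ) (σ : ℝ) (f : L2) :
    resolvent κ hκ σ f = (Lp.fourierTransformₗᵢ ℝ ℂ).symm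
      (mulOp (symbol κ σ) (memLp_top_symbol hκ σ) (Lp.fourierTransformₗᵢ ℝ ℂ f)) := rfl

theorem norm_resolvent_apply_le {κ : ℝ} (hκ : 0 < κ) (σ : ℝ) (f : L2) :
    ‖resolvent κ hκ σ f‖ ≤ κ⁻¹ * ‖f‖ := by
  rw [resolvent_apply, LinearIsometryEquiv.norm_map]
  refine (norm_mulOp_apply_le (memLp_top_symbol hκ σ)
    (Filter.Eventually.of_forall fun ξ => norm_resolvent_symbol_le hκ _) _).trans_eq ?_
  rw [LinearIsometryEquiv.norm_map]

theorem inner_resolvent {κ : ℝ} (hκ : 0 < κ) (u v : L2) :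
    inner ℂ (resolvent κ hκ 1 u) v = inner ℂ u (resolvent κ hκ (-1) v) := by
  set F := Lp.fourierTransformₗᵢ ℝ ℂ
  have h : ∀ w, mulOp (symbol κ 1) (memLp_top_symbol hκ 1) w =
      mulOp (star (symbol κ (-1))) (memLp_top_symbol hκ (-1)).star w := fun w => by
    refine Lp.ext ?_
    filter_upwards [coeFn_mulOp (symbol κ 1) (memLp_top_symbol hκ 1) w,
      coeFn_mulOp (star (symbol κ (-1))) (memLp_top_symbol hκ (-1)).star w] with x h1 h2
    rw [h1, h2, Pi.star_apply, ← symbol_neg, neg_neg]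
  rw [resolvent_apply, resolvent_apply, ← F.inner_map_map, F.apply_symm_apply, h,
    inner_mulOp_star _ (memLp_top_symbol hκ (-1)), ← F.inner_map_map u, F.apply_symm_apply]

/-- The kernel vector at x is the inverse transform of the conjugate of e^(2πixξ) times the symbol.
The phase has modulus one, so by Plancherel its norm does not depend on x. The product of the symbol
with the transform of f is integrable, so Fourier inversion holds pointwise almost everywhere. -/
theorem hasBoundedKernel_resolvent {κ : ℝ} (hκ : 0 < κ) {σ : ℝ} (hσ : σ ^ 2 = 1) :
    HasBoundedKernel (resolvent κ hκ σ) √((2 * κ)⁻¹) := by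
  set F := Lp.fourierTransformₗᵢ ℝ ℂ
  have hm : MemLp (symbol κ σ) 2 volume :=
    (memLp_two_iff_integrable_sq_norm (continuous_symbol hκ σ).aestronglyMeasurable).2
      (hasIntegral_norm_symbol_sq hκ hσ).1
  set e : ℝ → ℝ → ℂ := fun x ξ =>
    star (Complex.exp (((2 * Real.pi * (ξ * x) : ℝ) : ℂ) * Complex.I) * symbol κ σ ξ)
  have hen : ∀ x ξ, ‖e x ξ‖ = ‖symbol κ σ ξ‖ := fun x ξ => by
    simp only [e, norm_star, norm_mul, Complex.norm_exp_ofReal_mul_I, one_mul]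
  have hem : ∀ x, MemLp (e x) 2 volume := fun x => by
    refine hm.of_le (Continuous.aestronglyMeasurable ?_)
      (Filter.Eventually.of_forall fun ξ => (hen x ξ).le)
    have := continuous_symbol hκ σ
    simp only [e]
    fun_prop
  refine ⟨fun x => F.symm ((hem x).toLp (e x)), fun x => ?_, fun f => ?_⟩
  · rw [F.symm.norm_map]
    refine Real.le_sqrt_of_sq_le ?_
    rw [norm_sq_eq_integral_norm_sq, ← (hasIntegral_norm_symbol_sq hκ hσ).2]
    refine (integral_congr_ae ?_).le
    filter_upwards [(hem x).coeFn_toLp] with ξ hξ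
    rw [hξ, hen]
  · have hmul := coeFn_mulOp (symbol κ σ) (memLp_top_symbol hκ σ) (F f)
    have hint : Integrable (mulOp (symbol κ σ) (memLp_top_symbol hκ σ) (F f)) :=
      (hm.integrable_mul (Lp.memLp (F f))).congr hmul.symm
    rw [resolvent_apply]
    filter_upwards [coeFn_fourierInv_eq_integral hint] with x hx
    rw [hx, ← F.inner_map_map, F.apply_symm_apply, L2.inner_def, Real.fourierInv_eq']
    refine integral_congr_ae ?_
    filter_upwards [hmul, (hem x).coeFn_toLp] with ξ h1 h2
    rw [h1, h2, RCLike.inner_apply']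
    simp only [e, RCLike.star_def, RCLike.conj_conj, smul_eq_mul, RCLike.inner_apply, conj_trivial]
    ring_nf

/-- Splitting of `q` at a set `S` of frequencies. -/
theorem exists_frequency_split (q : 𝓢(ℝ, ℂ)) {S : Set ℝ} (hS : MeasurableSet S) :
    ∃ g h : ℝ → ℂ, MemLp g ∞ volume ∧ MemLp h ∞ volume ∧ MemLp h 2 volume ∧
      q =ᵐ[volume] g + h ∧ (∀ᵐ x, ‖g x‖ ≤ ∫ ξ in S, ‖𝓕 q ξ‖) ∧
      ∫ x, ‖h x‖ ^ 2 = ∫ ξ in Sᶜ, ‖𝓕 q ξ‖ ^ 2 := by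
  set F := Lp.fourierTransformₗᵢ ℝ ℂ
  have hmem : MemLp (S.indicator ⇑(𝓕 q : 𝓢(ℝ, ℂ))) 2 volume := ((𝓕 q).memLp 2).indicator hS
  set G : L2 := hmem.toLp _
  have hG : G =ᵐ[volume] S.indicator ⇑(𝓕 q : 𝓢(ℝ, ℂ)) := hmem.coeFn_toLp
  have hint : Integrable G := ((SchwartzMap.integrable (μ := volume) (𝓕 q)).indicator hS).congr hG.symm
  set g : L2 := F.symm G
  have hgb : ∀ᵐ x, ‖g x‖ ≤ ∫ ξ in S, ‖𝓕 q ξ‖ := by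
    filter_upwards [coeFn_fourierInv_eq_integral hint] with x hx
    rw [hx, Real.fourierInv_eq]
    refine (norm_integral_le_integral_norm _).trans_eq ?_
    rw [← integral_indicator hS]
    refine integral_congr_ae ?_
    filter_upwards [hG] with ξ hξ
    rw [Circle.norm_smul, hξ, norm_indicator_eq_indicator_norm]
  have hg : MemLp g ∞ volume := memLp_top_of_bound (Lp.aestronglyMeasurable g) _ hgb
  set h : L2 := q.toLp 2 volume - g
  have hh : h =ᵐ[volume] ⇑q - ⇑g := by
    filter_upwards [Lp.coeFn_sub (q.toLp 2) g, q.coeFn_toLp 2 volume] with x h1 h2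
    rw [h1, Pi.sub_apply, Pi.sub_apply, h2]
  refine ⟨g, h, hg, (q.memLp_top.sub hg).ae_eq hh.symm, Lp.memLp h, ?_, hgb, ?_⟩
  · filter_upwards [hh] with x hx
    rw [Pi.add_apply, hx, Pi.sub_apply, add_sub_cancel]
  · rw [← norm_sq_eq_integral_norm_sq, ← F.norm_map, map_sub, F.apply_symm_apply,
      norm_sq_eq_integral_norm_sq, ← integral_indicator hS.compl]
    have hFq : F (q.toLp 2 volume) = (𝓕 q).toLp 2 volume := SchwartzMap.toLp_fourier_eq q
    rw [hFq]
    refine integral_congr_ae ?_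
    filter_upwards [Lp.coeFn_sub ((𝓕 q).toLp 2 volume) G, (𝓕 q).coeFn_toLp 2 volume, hG] with ξ h1 h2 h3
    rw [h1, Pi.sub_apply, h2, h3]
    by_cases hξ : ξ ∈ S <;> simp [hξ]

/-- The square root of the weight has temperate growth, so its product with 𝓕 q is again Schwartz
and hence in L². -/
theorem integrable_sobolev_weight (s : ℝ) (q : 𝓢(ℝ, ℂ)) :
    Integrable fun ξ : ℝ => (1 + (2 * Real.pi * ξ) ^ 2) ^ s * ‖𝓕 q ξ‖ ^ 2 := by
  set w : ℝ → ℝ := fun ξ => (1 + ‖(2 * Real.pi) • ξ‖ ^ 2) ^ (s / 2)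
  have hw : w.HasTemperateGrowth :=
    (Function.hasTemperateGrowth_one_add_norm_sq_rpow ℝ (s / 2)).comp
      (((2 * Real.pi) • ContinuousLinearMap.id ℝ ℝ : ℝ →L[ℝ] ℝ).hasTemperateGrowth)
  have h := ((SchwartzMap.smulLeftCLM ℂ w (𝓕 q)).memLp 2 volume).integrable_norm_pow (by norm_num)
  refine h.congr (Filter.Eventually.of_forall fun ξ => ?_)
  simp only [SchwartzMap.smulLeftCLM_apply_apply hw]
  rw [norm_smul, mul_pow, Real.norm_of_nonneg (by positivity)]
  simp only [w, smul_eq_mul, Real.norm_eq_abs, sq_abs]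
  rw [← Real.rpow_natCast, ← Real.rpow_mul (by positivity)]
  norm_num

/-- By evenness it suffices to integrate over positive ξ, where the inverse weight is at most
ξ^(-2a). The bound a ≤ 1/4 makes this integrable at 0 and keeps 1/(1-2a) at most 2. -/
theorem integral_sobolev_weight_inv_le {a s κ : ℝ} (ha : 0 < a) (ha4 : a ≤ 1 / 4) (has : a ≤ s)
    (hκ : 0 < κ) :
    ∫ ξ in Set.Icc (-(κ / (2 * Real.pi))) (κ / (2 * Real.pi)),
      ((1 + (2 * Real.pi * ξ) ^ 2) ^ s)⁻¹ ≤ 4 * κ ^ (1 - 2 * a) := by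
  set N := κ / (2 * Real.pi)
  have hN : 0 < N := by positivity
  have hpi : 1 ≤ 2 * Real.pi := by linarith [Real.pi_gt_three]
  have hNκ : N ≤ κ := div_le_self hκ.le hpi
  set w : ℝ → ℝ := fun ξ => ((1 + (2 * Real.pi * ξ) ^ 2) ^ s)⁻¹
  have hwc : Continuous w := by
    refine Continuous.inv₀ (Continuous.rpow_const (by fun_prop) fun x => ?_) fun x => ?_
    · left; positivity
    · positivity
  have heven : ∫ ξ in (-N)..0, w ξ = ∫ ξ in (0 : ℝ)..N, w ξ := by
    have := intervalIntegral.integral_comp_neg (a := 0) (b := N) w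
    rw [neg_zero] at this
    rw [← this]
    simp [w]
  have hle : ∫ ξ in (0 : ℝ)..N, w ξ ≤ 2 * κ ^ (1 - 2 * a) := by
    calc ∫ ξ in (0 : ℝ)..N, w ξ ≤ ∫ ξ in (0 : ℝ)..N, ξ ^ (-(2 * a)) := by
          refine intervalIntegral.integral_mono_on_of_le_Ioo hN.le (hwc.intervalIntegrable _ _)
            (intervalIntegral.intervalIntegrable_rpow' (by linarith)) fun ξ hξ => ?_
          refine (sobolev_weight_inv_le ha has (mul_pos (by positivity) hξ.1)).trans ?_
          exact Real.rpow_le_rpow_of_nonpos hξ.1 (le_mul_of_one_le_left hξ.1.le hpi) (by linarith)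
      _ = N ^ (1 - 2 * a) / (1 - 2 * a) := by
          rw [integral_rpow (Or.inl (by linarith)), Real.zero_rpow (by linarith)]
          ring_nf
      _ ≤ κ ^ (1 - 2 * a) / (1 / 2) := by
          gcongr
          · linarith
          · linarith
      _ = _ := by ring
  rw [integral_Icc_eq_integral_Ioc, ← intervalIntegral.integral_of_le (by linarith),
    ← intervalIntegral.integral_add_adjacent_intervals (b := 0) (hwc.intervalIntegrable _ _)
      (hwc.intervalIntegrable _ _), heven]
  linarith

theorem laxOp_converges_of_split {κ : ℝ} (hκ : 0 < κ) (q : 𝓢(ℝ, ℂ)) {g h : ℝ → ℂ}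
    (hg : MemLp g ∞ volume) (hh : MemLp h ∞ volume) (hh2 : MemLp h 2 volume)
    (hsplit : q =ᵐ[volume] g + h) {L : ℝ} (hL : ∀ᵐ x, ‖g x‖ ≤ L) (hL0 : 0 ≤ L)
    (hsmall : κ * (L * κ⁻¹ + √((2 * κ)⁻¹) * √(∫ x, ‖h x‖ ^ 2)) ^ 2 ≤ 1 / 2) :
    AlphaSeriesConvergesGeometrically κ (laxOp κ hκ q) (1 / 2) ∧
      HasSum (fun l : ℕ => (alphaTerm κ (laxOp κ hκ q) (l + 1)).re) (alpha κ hκ q) := by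
  have h := alphaSeriesConvergesGeometrically_of_split hκ (Real.sqrt_nonneg _)
    (inner_resolvent hκ) (hasBoundedKernel_resolvent hκ (by norm_num))
    (hasBoundedKernel_resolvent hκ (by norm_num)) (norm_resolvent_apply_le hκ _)
    (norm_resolvent_apply_le hκ _) q.memLp_top (q.memLp 2) hg hh hh2 hsplit hL hL0 hsmall
  exact ⟨h, h.hasSum_re (by norm_num) (by norm_num)⟩

theorem converges_of_l2Norm_le {κ : ℝ} (hκ : 0 < κ) (q : 𝓢(ℝ, ℂ)) (hq : l2Norm q ≤ 1) :
    AlphaSeriesConvergesGeometrically κ (laxOp κ hκ q) (1 / 2) ∧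
      HasSum (fun l : ℕ => (alphaTerm κ (laxOp κ hκ q) (l + 1)).re) (alpha κ hκ q) := by
  refine laxOp_converges_of_split hκ q (g := 0) (h := q) MemLp.zero q.memLp_top (q.memLp 2)
    (by simp) (L := 0) (by simp) le_rfl ?_
  change κ * (0 * κ⁻¹ + √((2 * κ)⁻¹) * l2Norm q) ^ 2 ≤ 1 / 2
  have h0 : 0 ≤ l2Norm q := Real.sqrt_nonneg _
  rw [zero_mul, zero_add, mul_pow, Real.sq_sqrt (by positivity)]
  calc κ * ((2 * κ)⁻¹ * l2Norm q ^ 2) = l2Norm q ^ 2 / 2 := by field_simp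
    _ ≤ 1 / 2 := by
      gcongr
      exact pow_le_one₀ h0 hq

theorem converges_of_sobolevNorm_le {s : ℝ} (hs : 0 < s) :
    ∃ C > (0 : ℝ), ∀ (κ : ℝ) (hκ : 0 < κ) (q : 𝓢(ℝ, ℂ)),
      C * sobolevNorm s q ^ (1 / min (1 / 4) s) ≤ κ →
        AlphaSeriesConvergesGeometrically κ (laxOp κ hκ q) (1 / 2) ∧
        HasSum (fun l : ℕ => (alphaTerm κ (laxOp κ hκ q) (l + 1)).re) (alpha κ hκ q) := by
  set a := min (1 / 4) s
  have ha : 0 < a := lt_min (by norm_num) hs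
  have ha4 : a ≤ 1 / 4 := min_le_left _ _
  have has : a ≤ s := min_le_right _ _
  -- The low frequencies contribute 2 to D and the high frequencies 1.
  obtain ⟨C, hC, hCS⟩ := exists_const_of_scaling ha (D := 3) (by norm_num)
  refine ⟨C, hC, fun κ hκ q hq => ?_⟩
  set S := sobolevNorm s q
  have hS : 0 ≤ S := Real.sqrt_nonneg _
  set w : ℝ → ℝ := fun ξ => (1 + (2 * Real.pi * ξ) ^ 2) ^ s
  have hw : ∀ ξ, 0 < w ξ := fun ξ => by positivity
  have hwc : Continuous w := Continuous.rpow_const (by fun_prop) fun x => Or.inl (by positivity)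
  have hint : Integrable fun ξ => w ξ * ‖𝓕 q ξ‖ ^ 2 := integrable_sobolev_weight s q
  have hnn : ∀ ξ, 0 ≤ w ξ * ‖𝓕 q ξ‖ ^ 2 := fun ξ => by positivity
  have hS2 : ∫ ξ, w ξ * ‖𝓕 q ξ‖ ^ 2 = S ^ 2 :=
    (Real.sq_sqrt (integral_nonneg hnn)).symm
  -- In this Fourier normalization the physical frequency is 2πξ, so the cutoff is |2πξ| ≤ κ.
  set B := Set.Icc (-(κ / (2 * Real.pi))) (κ / (2 * Real.pi))
  obtain ⟨g, h, hg, hh, hh2, hsplit, hgB, hhB⟩ :=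
    exists_frequency_split q (S := B) measurableSet_Icc
  refine laxOp_converges_of_split hκ q hg hh hh2 hsplit hgB
    (integral_nonneg fun _ => norm_nonneg _) (le_trans ?_ (hCS κ hκ S hS hq))
  have hlow : ∫ ξ in B, ‖𝓕 q ξ‖ ≤ 2 * κ ^ (1 / 2 - a) * S := by
    -- Cauchy–Schwarz after inserting the Sobolev weight as w^(-1/2) · w^(1/2).
    have hcs := integral_mul_le_sqrt_mul_sqrt (μ := volume.restrict B)
      (f := fun ξ => (√(w ξ))⁻¹) (g := fun ξ => √(w ξ) * ‖𝓕 q ξ‖)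
      (fun ξ => by positivity) (fun ξ => by positivity)
      (by
        refine (memLp_two_iff_integrable_sq (Continuous.aestronglyMeasurable ?_)).2
          (Continuous.integrableOn_Icc ?_)
        · exact hwc.sqrt.inv₀ fun x => (Real.sqrt_pos.2 (hw x)).ne'
        · exact (hwc.sqrt.inv₀ fun x => (Real.sqrt_pos.2 (hw x)).ne').pow 2)
      (by
        have hc : Continuous fun ξ => √(w ξ) * ‖𝓕 q ξ‖ := hwc.sqrt.mul (𝓕 q).continuous.norm
        exact (memLp_two_iff_integrable_sq hc.aestronglyMeasurable).2
          (hc.pow 2).integrableOn_Icc)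
    have e1 : ∀ ξ, (√(w ξ))⁻¹ * (√(w ξ) * ‖𝓕 q ξ‖) = ‖𝓕 q ξ‖ := fun ξ =>
      inv_mul_cancel_left₀ (Real.sqrt_pos.2 (hw ξ)).ne' _
    have e2 : ∀ ξ, (√(w ξ))⁻¹ ^ 2 = (w ξ)⁻¹ := fun ξ => by
      rw [inv_pow, Real.sq_sqrt (hw ξ).le]
    have e3 : ∀ ξ, (√(w ξ) * ‖𝓕 q ξ‖) ^ 2 = w ξ * ‖𝓕 q ξ‖ ^ 2 := fun ξ => by
      rw [mul_pow, Real.sq_sqrt (hw ξ).le]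
    simp only [e1, e2, e3] at hcs
    refine hcs.trans (mul_le_mul ?_ ?_ (Real.sqrt_nonneg _) (by positivity))
    · refine Real.sqrt_le_iff.2 ⟨by positivity, ?_⟩
      refine (integral_sobolev_weight_inv_le ha ha4 has hκ).trans_eq ?_
      rw [mul_pow, ← Real.rpow_natCast (κ ^ (1 / 2 - a)), ← Real.rpow_mul hκ.le]
      norm_num
      ring_nf
    · refine Real.sqrt_le_iff.2 ⟨hS, ?_⟩
      rw [← hS2]
      exact setIntegral_le_integral hint (Filter.Eventually.of_forall hnn)
  have hhigh : √(∫ x, ‖h x‖ ^ 2) ≤ κ ^ (-a) * S := by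
    refine Real.sqrt_le_iff.2 ⟨by positivity, ?_⟩
    have hκa : (κ ^ (-a)) ^ 2 = (κ ^ (2 * a))⁻¹ := by
      rw [← Real.rpow_natCast, ← Real.rpow_mul hκ.le, ← Real.rpow_neg hκ.le]
      norm_num
      ring_nf
    rw [hhB, mul_pow, hκa, ← hS2, ← integral_const_mul]
    refine le_trans ?_ (setIntegral_le_integral (s := Bᶜ) (hint.const_mul _)
      (Filter.Eventually.of_forall fun ξ => mul_nonneg (by positivity) (hnn ξ)))
    refine setIntegral_mono_on (((𝓕 q).memLp 2).integrable_norm_pow (by norm_num)).integrableOn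
      (hint.const_mul _).integrableOn measurableSet_Icc.compl fun ξ hξ => ?_
    have hκξ : κ ≤ |2 * Real.pi * ξ| := by
      by_contra hlt
      push Not at hlt
      refine hξ ?_
      rw [abs_mul, abs_of_pos Real.two_pi_pos, mul_comm, ← lt_div_iff₀ Real.two_pi_pos] at hlt
      exact ⟨(abs_lt.1 hlt).1.le, (abs_lt.1 hlt).2.le⟩
    have := rpow_le_sobolev_weight ha has hκ hκξ
    rw [← mul_assoc]
    refine le_mul_of_one_le_left (by positivity) ?_
    rw [inv_mul_eq_div, one_le_div (by positivity)]
    exact this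
  have hK : √((2 * κ)⁻¹) ≤ κ ^ (-(1 / 2) : ℝ) := by
    rw [Real.sqrt_eq_rpow, Real.rpow_neg hκ.le, ← Real.inv_rpow hκ.le]
    gcongr
    linarith
  gcongr
  calc (∫ ξ in B, ‖𝓕 q ξ‖) * κ⁻¹ + √((2 * κ)⁻¹) * √(∫ x, ‖h x‖ ^ 2)
      ≤ 2 * κ ^ (1 / 2 - a) * S * κ⁻¹ + κ ^ (-(1 / 2) : ℝ) * (κ ^ (-a) * S) := by gcongr
    _ = 2 * (κ ^ (1 / 2 - a) * κ ^ (-1 : ℝ)) * S + (κ ^ (-(1 / 2) : ℝ) * κ ^ (-a)) * S := by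
        rw [Real.rpow_neg_one]; ring
    _ = 3 * κ ^ (-(1 / 2) - a : ℝ) * S := by
        rw [← Real.rpow_add hκ, ← Real.rpow_add hκ]
        ring_nf

end Line

/-! ## The circle -/

namespace Torus

open AddCircle

theorem sum_Icc_even {f : ℤ → ℝ} (hf : ∀ n, f (-n) = f n) (N : ℕ) :
    ∑ n ∈ Finset.Icc (-N : ℤ) N, f n = f 0 + 2 * ∑ n ∈ Finset.range N, f ((n : ℤ) + 1) := by
  rw [Finset.sum_Icc_of_even_eq_range (fun n => hf n), Finset.sum_range_succ']
  push_cast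
  simp only [nsmul_eq_mul]
  push_cast
  ring

theorem exists_subset_Icc (s : Finset ℤ) : ∃ N : ℕ, s ⊆ Finset.Icc (-N : ℤ) N := by
  refine ⟨s.sup Int.natAbs, fun n hn => ?_⟩
  have := Finset.le_sup (f := Int.natAbs) hn
  rw [Finset.mem_Icc]
  omega

/-- Since κ² + m² ≥ (κ+m)²/2, the terms with m ≥ 1 are dominated by a telescoping sum with total at
most 2/κ on each side of zero. The zero mode is κ⁻² ≤ κ⁻¹/κ₀, the only use of κ₀. -/
theorem sum_resolvent_weight_le {κ₀ κ : ℝ} (hκ₀ : 0 < κ₀) (hκ : κ₀ ≤ κ) (s : Finset ℤ) :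
    ∑ n ∈ s, (κ ^ 2 + (n : ℝ) ^ 2)⁻¹ ≤ (1 / κ₀ + 4) * κ⁻¹ := by
  have hκ' : 0 < κ := hκ₀.trans_le hκ
  have key : ∀ N : ℕ, ∑ n ∈ Finset.range N, (κ ^ 2 + ((n : ℝ) + 1) ^ 2)⁻¹ ≤
      2 / κ - 2 / (κ + N) := by
    intro N
    induction N with
    | zero => simp
    | succ N ih =>
      rw [Finset.sum_range_succ]
      have h1 : 2 / (κ + N) - 2 / (κ + (N + 1)) = 2 / ((κ + N) * (κ + (N + 1))) := by
        field_simp; ring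
      have h2 : (κ ^ 2 + ((N : ℝ) + 1) ^ 2)⁻¹ ≤ 2 / ((κ + N) * (κ + (N + 1))) := by
        rw [inv_eq_one_div, div_le_div_iff₀ (by positivity) (by positivity)]
        nlinarith [sq_nonneg (κ - (N + 1)), hκ', (Nat.cast_nonneg N : (0 : ℝ) ≤ N)]
      push_cast
      linarith
  obtain ⟨N, hN⟩ := exists_subset_Icc s
  calc ∑ n ∈ s, (κ ^ 2 + (n : ℝ) ^ 2)⁻¹
      ≤ ∑ n ∈ Finset.Icc (-N : ℤ) N, (κ ^ 2 + (n : ℝ) ^ 2)⁻¹ :=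
        Finset.sum_le_sum_of_subset_of_nonneg hN fun _ _ _ => by positivity
    _ = (κ ^ 2)⁻¹ + 2 * ∑ n ∈ Finset.range N, (κ ^ 2 + ((n : ℝ) + 1) ^ 2)⁻¹ := by
        rw [sum_Icc_even (f := fun n : ℤ => (κ ^ 2 + (n : ℝ) ^ 2)⁻¹) (by simp)]
        simp
    _ ≤ (κ ^ 2)⁻¹ + 2 * (2 / κ) := by
        gcongr
        exact (key N).trans (sub_le_self _ (by positivity))
    _ = (1 / κ + 4) * κ⁻¹ := by field_simp; ring
    _ ≤ _ := by gcongr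

/-- For 1 ≤ m ≤ κ write m^(-2a) = m^(1/2-2a) m^(-1/2). The first exponent is nonnegative because a ≤
1/4, so m may be replaced by κ there, and the sum of m^(-1/2) telescopes to at most 2√κ. The zero
mode contributes 1, absorbed by means of κ ≥ κ₀. -/
theorem sum_sobolev_weight_inv_le {a s κ₀ κ : ℝ} (ha : 0 < a) (ha4 : a ≤ 1 / 4) (has : a ≤ s)
    (hκ₀ : 0 < κ₀) (hκ : κ₀ ≤ κ) :
    ∑ n ∈ Finset.Icc (-⌊κ⌋₊ : ℤ) ⌊κ⌋₊, ((1 + (n : ℝ) ^ 2) ^ s)⁻¹ ≤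
      ((κ₀ ^ (1 - 2 * a))⁻¹ + 4) * κ ^ (1 - 2 * a) := by
  have hκ' : 0 < κ := hκ₀.trans_le hκ
  have key : ∀ N : ℕ, ∑ n ∈ Finset.range N, (√((n : ℝ) + 1))⁻¹ ≤ 2 * √N := by
    intro N
    induction N with
    | zero => simp
    | succ N ih =>
      rw [Finset.sum_range_succ]
      have h0 : 0 < √((N : ℝ) + 1) := Real.sqrt_pos.2 (by positivity)
      have h1 : (√((N : ℝ) + 1))⁻¹ ≤ 2 * (√((N : ℝ) + 1) - √N) := by
        rw [inv_le_iff_one_le_mul₀ h0]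
        nlinarith [Real.sq_sqrt (by positivity : (0 : ℝ) ≤ (N : ℝ) + 1),
          Real.sq_sqrt (by positivity : (0 : ℝ) ≤ (N : ℝ)), sq_nonneg (√((N : ℝ) + 1) - √N)]
      push_cast
      linarith
  have hterm : ∀ n ∈ Finset.range ⌊κ⌋₊, ((1 + ((n : ℝ) + 1) ^ 2) ^ s)⁻¹ ≤
      κ ^ (1 / 2 - 2 * a) * (√((n : ℝ) + 1))⁻¹ := fun n hn => by
    have hn1 : (0 : ℝ) < (n : ℝ) + 1 := by positivity
    have hnκ : (n : ℝ) + 1 ≤ κ := by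
      have : n + 1 ≤ ⌊κ⌋₊ := Finset.mem_range.1 hn
      exact_mod_cast (Nat.le_floor_iff hκ'.le).1 this
    refine (sobolev_weight_inv_le ha has hn1).trans ?_
    calc ((n : ℝ) + 1) ^ (-(2 * a))
        = ((n : ℝ) + 1) ^ (1 / 2 - 2 * a) * ((n : ℝ) + 1) ^ (-(1 / 2) : ℝ) := by
          rw [← Real.rpow_add hn1]; ring_nf
      _ = ((n : ℝ) + 1) ^ (1 / 2 - 2 * a) * (√((n : ℝ) + 1))⁻¹ := by
          rw [Real.rpow_neg hn1.le, Real.sqrt_eq_rpow]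
      _ ≤ _ := by
          gcongr
          linarith
  have hpow : κ ^ (1 / 2 - 2 * a) * √κ = κ ^ (1 - 2 * a) := by
    rw [Real.sqrt_eq_rpow, ← Real.rpow_add hκ']; ring_nf
  have hone : 1 ≤ (κ₀ ^ (1 - 2 * a))⁻¹ * κ ^ (1 - 2 * a) := by
    rw [inv_mul_eq_div, one_le_div (by positivity)]
    exact Real.rpow_le_rpow hκ₀.le hκ (by linarith)
  calc ∑ n ∈ Finset.Icc (-⌊κ⌋₊ : ℤ) ⌊κ⌋₊, ((1 + (n : ℝ) ^ 2) ^ s)⁻¹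
      = 1 + 2 * ∑ n ∈ Finset.range ⌊κ⌋₊, ((1 + ((n : ℝ) + 1) ^ 2) ^ s)⁻¹ := by
        rw [sum_Icc_even (f := fun n : ℤ => ((1 + (n : ℝ) ^ 2) ^ s)⁻¹) (by simp)]
        simp
    _ ≤ 1 + 2 * (κ ^ (1 / 2 - 2 * a) * (2 * √κ)) := by
        gcongr
        refine (Finset.sum_le_sum hterm).trans ?_
        rw [← Finset.mul_sum]
        gcongr
        refine (key _).trans ?_
        gcongr
        exact Nat.floor_le hκ'.le
    _ = 1 + 4 * κ ^ (1 - 2 * a) := by rw [← hpow]; ring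
    _ ≤ _ := by linarith

/-- The symbol of `(κ + σ ∂)⁻¹`. -/
def symbol (κ σ : ℝ) (n : ℤ) : ℂ := ((κ : ℂ) + Complex.I * ((σ * n : ℝ) : ℂ))⁻¹

theorem symbol_neg (κ σ : ℝ) (n : ℤ) : symbol κ (-σ) n = star (symbol κ σ n) := by
  simp [symbol, Complex.conj_ofReal]

theorem norm_symbol_sq {κ σ : ℝ} (hσ : σ ^ 2 = 1) (n : ℤ) :
    ‖symbol κ σ n‖ ^ 2 = (κ ^ 2 + (n : ℝ) ^ 2)⁻¹ := by
  rw [symbol, norm_inv, inv_pow, ← Complex.normSq_eq_norm_sq, Complex.normSq_apply]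
  simp
  linear_combination (n : ℝ) ^ 2 * hσ

/-- The Fourier coefficients of an `L²` function. -/
abbrev coeffs : L2 ≃ₗᵢ[ℂ] lp (fun _ : ℤ => ℂ) 2 := (fourierBasis (T := 2 * Real.pi)).repr

theorem coeffs_resolvent {κ : ℝ} (hκ : 0 < κ) (σ : ℝ) (f : L2) (n : ℤ) :
    coeffs (resolvent κ hκ σ f) n = symbol κ σ n * coeffs f n := by
  change coeffs (coeffs.symm _) n = _
  rw [LinearIsometryEquiv.apply_symm_apply]
  rfl

theorem norm_resolvent_apply_le {κ : ℝ} (hκ : 0 < κ) (σ : ℝ) (f : L2) :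
    ‖resolvent κ hκ σ f‖ ≤ κ⁻¹ * ‖f‖ := by
  change ‖coeffs.symm (lp.mapCLM 2 _ (inv_nonneg.2 hκ.le) (norm_symbol_smul_id_le hκ σ)
    (coeffs f))‖ ≤ _
  rw [LinearIsometryEquiv.norm_map, ← coeffs.norm_map f]
  exact ContinuousLinearMap.le_of_opNorm_le _ (lp.norm_mapCLM_le ..) _

theorem inner_resolvent {κ : ℝ} (hκ : 0 < κ) (u v : L2) :
    inner ℂ (resolvent κ hκ 1 u) v = inner ℂ u (resolvent κ hκ (-1) v) := by
  rw [← coeffs.inner_map_map, ← coeffs.inner_map_map u, lp.inner_eq_tsum, lp.inner_eq_tsum]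
  refine tsum_congr fun n => ?_
  rw [coeffs_resolvent, coeffs_resolvent, symbol_neg]
  simp only [RCLike.inner_apply', RCLike.star_def, map_mul]
  ring

theorem norm_sq_lp (x : lp (fun _ : ℤ => ℂ) 2) : HasSum (fun n => ‖x n‖ ^ 2) (‖x‖ ^ 2) := by
  have := lp.hasSum_norm (p := 2) (by norm_num) x
  simpa using this

theorem memℓp_two_of_sum_le {c : ℤ → ℂ} {D : ℝ} (hc : ∀ s : Finset ℤ, ∑ n ∈ s, ‖c n‖ ^ 2 ≤ D) :
    Memℓp c 2 := by
  refine memℓp_gen' (C := D) fun s => ?_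
  simpa using hc s

/-- An absolutely summable Fourier series converges uniformly to a continuous function, which agrees
with u in L² and therefore almost everywhere. -/
theorem coeFn_eq_of_hasSum {u : L2} {c : ℤ → ℂ} (hc : Summable fun n => ‖c n‖)
    (hu : ∀ n, coeffs u n = c n) :
    ∀ᵐ x ∂(haarAddCircle : Measure T), HasSum (fun n => c n * fourier n x) (u x) := by
  have hs : Summable fun n => c n • (fourier n : C(T, ℂ)) := by
    refine Summable.of_norm ?_
    simpa only [norm_smul, fourier_norm, mul_one] using hc
  obtain ⟨G, hG⟩ := hs
  have h1 : HasSum (fun n => c n • fourierLp 2 n) (ContinuousMap.toLp 2 haarAddCircle ℂ G) := by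
    simpa using hG.mapL (ContinuousMap.toLp (E := ℂ) 2 (haarAddCircle : Measure T) ℂ)
  have h2 : HasSum (fun n => c n • fourierLp 2 n) u := by
    have := fourierBasis.hasSum_repr u
    simp only [coe_fourierBasis] at this
    simpa only [← hu] using this
  rw [h2.unique h1]
  filter_upwards [ContinuousMap.coeFn_toLp (𝕜 := ℂ) (p := 2) (haarAddCircle : Measure T) G]
    with x hx
  rw [hx]
  simpa using (ContinuousMap.evalCLM ℂ x).hasSum hG

theorem hasBoundedKernel_resolvent {κ₀ κ : ℝ} (hκ₀ : 0 < κ₀) (hκκ : κ₀ ≤ κ) (hκ : 0 < κ) {σ : ℝ}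
    (hσ : σ ^ 2 = 1) :
    HasBoundedKernel (resolvent κ hκ σ) √((1 / κ₀ + 4) * κ⁻¹) := by
  set e : T → ℤ → ℂ := fun x n => star (symbol κ σ n * fourier n x)
  have hen : ∀ x n, ‖e x n‖ ^ 2 = (κ ^ 2 + (n : ℝ) ^ 2)⁻¹ := fun x n => by
    rw [← norm_symbol_sq hσ]
    simp only [e, norm_star, norm_mul, fourier_apply, Circle.norm_coe, mul_one]
  have hes : ∀ x, ∀ s : Finset ℤ, ∑ n ∈ s, ‖e x n‖ ^ 2 ≤ (1 / κ₀ + 4) * κ⁻¹ := fun x s => by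
    simp_rw [hen]
    exact sum_resolvent_weight_le hκ₀ hκκ s
  refine ⟨fun x => coeffs.symm ⟨e x, memℓp_two_of_sum_le (hes x)⟩, fun x => ?_, fun f => ?_⟩
  · rw [LinearIsometryEquiv.norm_map]
    exact Real.le_sqrt_of_sq_le (hasSum_le_of_sum_le (norm_sq_lp _) (hes x))
  -- A product of two ℓ² sequences is summable, so the Fourier series of the resolvent may be
  -- evaluated pointwise.
  · have hsum : Summable fun n => ‖symbol κ σ n * coeffs f n‖ := by
      have h1 : Summable fun n : ℤ => (κ ^ 2 + (n : ℝ) ^ 2)⁻¹ :=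
        summable_of_sum_le (fun _ => by positivity) (sum_resolvent_weight_le hκ₀ hκκ)
      refine Summable.of_nonneg_of_le (fun _ => norm_nonneg _) (fun n => ?_)
        (h1.add (norm_sq_lp (coeffs f)).summable)
      rw [norm_mul, ← norm_symbol_sq hσ]
      nlinarith [sq_nonneg (‖symbol κ σ n‖ - ‖coeffs f n‖), sq_nonneg ‖symbol κ σ n‖,
        sq_nonneg ‖coeffs f n‖]
    filter_upwards [coeFn_eq_of_hasSum hsum (coeffs_resolvent hκ σ f)] with x hx
    rw [← hx.tsum_eq, ← coeffs.inner_map_map, LinearIsometryEquiv.apply_symm_apply,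
      lp.inner_eq_tsum]
    refine tsum_congr fun n => ?_
    simp only [e, RCLike.inner_apply', RCLike.star_def, RCLike.conj_conj]
    ring

theorem memLp_two (q : C(T, ℂ)) : MemLp q 2 (haarAddCircle : Measure T) :=
  (memLp_top q).mono_exponent le_top

theorem hasSum_norm_sq_fourierCoeff (q : C(T, ℂ)) :
    HasSum (fun n => ‖fourierCoeff q n‖ ^ 2) (∫ x, ‖q x‖ ^ 2 ∂(haarAddCircle : Measure T)) := by
  have h := hasSum_sq_fourierCoeff (ContinuousMap.toLp (E := ℂ) 2 (haarAddCircle : Measure T) ℂ q)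
  simp_rw [fourierCoeff_toLp] at h
  convert h using 1
  refine integral_congr_ae ?_
  filter_upwards [ContinuousMap.coeFn_toLp (𝕜 := ℂ) (p := 2) (haarAddCircle : Measure T) q]
    with x hx
  rw [hx]

theorem fourierCoeff_sub_partialSum (q : C(T, ℂ)) (S : Finset ℤ) (n : ℤ) :
    fourierCoeff (q - ∑ m ∈ S, fourierCoeff q m • fourier m : C(T, ℂ)) n =
      if n ∈ S then 0 else fourierCoeff q n := by
  set Φ := ContinuousMap.toLp (E := ℂ) 2 (haarAddCircle : Measure T) ℂ
  have h : ∀ u : C(T, ℂ), fourierCoeff u n = inner ℂ (fourierLp 2 n) (Φ u) := fun u => by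
    rw [← fourierCoeff_toLp, ← fourierBasis_repr, HilbertBasis.repr_apply_apply, coe_fourierBasis]
  have hmono : ∀ m, inner ℂ (fourierLp 2 n) (Φ (fourier m)) = if n = m then (1 : ℂ) else 0 :=
    fun m => orthonormal_iff_ite.1 (orthonormal_fourier (T := 2 * Real.pi)) n m
  rw [h, map_sub, map_sum, inner_sub_right, inner_sum, ← h q]
  simp_rw [map_smul, inner_smul_right, hmono]
  by_cases hn : n ∈ S <;> simp [hn]

theorem laxOp_converges_of_split {κ₀ κ : ℝ} (hκ₀ : 0 < κ₀) (hκκ : κ₀ ≤ κ) (hκ : 0 < κ)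
    (q g h : C(T, ℂ)) (hsplit : q = g + h) {L : ℝ} (hL : ∀ x, ‖g x‖ ≤ L) (hL0 : 0 ≤ L)
    (hsmall : κ * (L * κ⁻¹ + √((1 / κ₀ + 4) * κ⁻¹) *
      √(∫ x, ‖h x‖ ^ 2 ∂(haarAddCircle : Measure T))) ^ 2 ≤ 1 / 2) :
    AlphaSeriesConvergesGeometrically κ (laxOp κ hκ q) (1 / 2) ∧
      HasSum (fun l : ℕ => (alphaTerm κ (laxOp κ hκ q) (l + 1)).re) (alpha κ hκ q) := by
  have h := alphaSeriesConvergesGeometrically_of_split hκ (Real.sqrt_nonneg _)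
    (inner_resolvent hκ) (hasBoundedKernel_resolvent hκ₀ hκκ hκ (by norm_num))
    (hasBoundedKernel_resolvent hκ₀ hκκ hκ (by norm_num)) (norm_resolvent_apply_le hκ _)
    (norm_resolvent_apply_le hκ _) (memLp_top q) (memLp_two q) (memLp_top g) (memLp_top h)
    (memLp_two h) (by rw [hsplit]; rfl) (Filter.Eventually.of_forall hL) hL0 hsmall
  exact ⟨h, h.hasSum_re (by norm_num) (by norm_num)⟩

theorem l2Norm_sq (q : C(T, ℂ)) :
    l2Norm q ^ 2 = 2 * Real.pi * ∫ x, ‖q x‖ ^ 2 ∂(haarAddCircle : Measure T) := by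
  have h := AddCircle.intervalIntegral_preimage (2 * Real.pi) 0 (fun x : T => ‖q x‖ ^ 2)
  rw [zero_add] at h
  rw [l2Norm, h, integral_haarAddCircle, smul_eq_mul,
    mul_inv_cancel_left₀ Real.two_pi_pos.ne', Real.sq_sqrt (integral_nonneg fun _ => by positivity)]

theorem converges_of_l2Norm_le {κ₀ : ℝ} (hκ₀ : 0 < κ₀) :
    ∃ c > (0 : ℝ), ∀ (κ : ℝ) (hκ : 0 < κ) (q : C(T, ℂ)), κ₀ ≤ κ → l2Norm q ≤ c →
      AlphaSeriesConvergesGeometrically κ (laxOp κ hκ q) (1 / 2) ∧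
      HasSum (fun l : ℕ => (alphaTerm κ (laxOp κ hκ q) (l + 1)).re) (alpha κ hκ q) := by
  have hD : 0 < 2 * (1 / κ₀ + 4) := by positivity
  -- Chosen so that the squared kernel constant 1/κ₀ + 4 times c² is 1/2; the gain 1/(2π) from
  -- normalized measure is discarded.
  refine ⟨√((2 * (1 / κ₀ + 4))⁻¹), Real.sqrt_pos.2 (inv_pos.2 hD), fun κ hκ q hκκ hq => ?_⟩
  refine laxOp_converges_of_split hκ₀ hκκ hκ q 0 q (by simp) (L := 0) (by simp) le_rfl ?_
  have h0 : 0 ≤ l2Norm q := Real.sqrt_nonneg _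
  have hI : 0 ≤ ∫ x, ‖q x‖ ^ 2 ∂(haarAddCircle : Measure T) :=
    integral_nonneg fun _ => by positivity
  have h1 : ∫ x, ‖q x‖ ^ 2 ∂(haarAddCircle : Measure T) ≤ (2 * (1 / κ₀ + 4))⁻¹ := by
    calc _ ≤ l2Norm q ^ 2 := by
          rw [l2Norm_sq]
          exact le_mul_of_one_le_left hI (by linarith [Real.pi_gt_three])
      _ ≤ √((2 * (1 / κ₀ + 4))⁻¹) ^ 2 := by gcongr
      _ = _ := Real.sq_sqrt (inv_pos.2 hD).le
  rw [zero_mul, zero_add, mul_pow, Real.sq_sqrt (by positivity), Real.sq_sqrt hI]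
  calc κ * ((1 / κ₀ + 4) * κ⁻¹ * ∫ x, ‖q x‖ ^ 2 ∂(haarAddCircle : Measure T))
      = (1 / κ₀ + 4) * ∫ x, ‖q x‖ ^ 2 ∂(haarAddCircle : Measure T) := by
        field_simp
    _ ≤ (1 / κ₀ + 4) * (2 * (1 / κ₀ + 4))⁻¹ := by gcongr
    _ = 1 / 2 := by
        have : 1 / κ₀ + 4 ≠ 0 := by positivity
        rw [mul_inv_rev, mul_inv_cancel_left₀ this]; norm_num

/-- The Fourier coefficients of a smooth periodic function decay rapidly. -/
theorem exists_pow_mul_fourierCoeffOn_le (k : ℕ) : ∀ f : ℝ → ℂ, ContDiff ℝ ∞ f →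
    f.Periodic (2 * Real.pi) →
    ∃ C, ∀ n : ℤ, |(n : ℝ)| ^ k * ‖fourierCoeffOn Real.two_pi_pos f n‖ ≤ C := by
  induction k with
  | zero =>
    intro f hf _
    obtain ⟨M, hM⟩ := (isCompact_uIcc (a := 0) (b := 2 * Real.pi)).exists_bound_of_continuousOn
      hf.continuous.continuousOn
    refine ⟨M, fun n => ?_⟩
    rw [pow_zero, one_mul, fourierCoeffOn_eq_integral, sub_zero, norm_smul,
      Real.norm_of_nonneg (by positivity), one_div, inv_mul_le_iff₀ Real.two_pi_pos]
    have := intervalIntegral.norm_integral_le_of_norm_le_const (a := 0) (b := 2 * Real.pi) (C := M)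
      (f := fun x => fourier (-n) (x : AddCircle (2 * Real.pi - 0)) • f x) (fun x hx => by
        rw [norm_smul, fourier_apply, Circle.norm_coe, one_mul]
        exact hM x (Set.uIoc_subset_uIcc hx))
    rwa [sub_zero, abs_of_pos Real.two_pi_pos, mul_comm M] at this
  | succ k ih =>
    intro f hf hper
    have hd : ContDiff ℝ ∞ (deriv f) := (contDiff_infty_iff_deriv.1 hf).2
    have hdper : (deriv f).Periodic (2 * Real.pi) := fun x => by
      rw [← deriv_comp_add_const]
      congr 1
      exact funext hper
    obtain ⟨C, hC⟩ := ih (deriv f) hd hdper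
    refine ⟨max C 0, fun n => ?_⟩
    rcases eq_or_ne n 0 with rfl | hn
    · simp
    refine le_trans (le_of_eq ?_) ((hC n).trans (le_max_left _ _))
    have hderiv : ∀ x ∈ Set.uIcc 0 (2 * Real.pi), HasDerivAt f (deriv f x) x := fun x _ =>
      ((contDiff_infty_iff_deriv.1 hf).1 x).hasDerivAt
    have hper0 : f (2 * Real.pi) = f 0 := by simpa using hper 0
    have hn' : |(n : ℝ)| ≠ 0 := by simpa using hn
    -- Integration by parts: periodicity kills the boundary term, and each derivative yields one
    -- power of n.
    rw [fourierCoeffOn_of_hasDerivAt Real.two_pi_pos hn hderiv (hd.continuous.intervalIntegrable _ _),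
      hper0, sub_self, mul_zero, zero_sub, pow_succ]
    simp only [norm_mul, norm_div, norm_neg, norm_one, Complex.norm_I, Complex.norm_real,
      Complex.norm_intCast, Complex.ofReal_zero, sub_zero, mul_one, Complex.norm_ofNat,
      Real.norm_eq_abs, abs_of_pos Real.pi_pos, Complex.ofReal_mul, Complex.ofReal_ofNat]
    have := Real.pi_pos
    field_simp

theorem fourierCoeff_eq_fourierCoeffOn (q : C(T, ℂ)) (n : ℤ) :
    fourierCoeff q n = fourierCoeffOn Real.two_pi_pos (fun x : ℝ => q (x : T)) n := by
  rw [fourierCoeff_eq_intervalIntegral q n 0, fourierCoeffOn_eq_integral, zero_add, sub_zero]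

theorem summable_sobolev_weight (s : ℝ) (q : C(T, ℂ)) (hq : IsSmooth q) :
    Summable fun n : ℤ => (1 + (n : ℝ) ^ 2) ^ s * ‖fourierCoeff q n‖ ^ 2 := by
  set m := ⌈s⌉₊
  -- The power m ≥ s beats the weight, and the extra one leaves the summable tail n⁻².
  obtain ⟨C, hC⟩ := exists_pow_mul_fourierCoeffOn_le (m + 1) _ hq
    (fun x => by simp)
  simp_rw [← fourierCoeff_eq_fourierCoeffOn] at hC
  refine Summable.of_norm_bounded_eventually
    ((Real.summable_one_div_int_pow (p := 2)).2 (by norm_num) |>.mul_left (2 ^ m * C ^ 2)) ?_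
  have hfin : {n : ℤ | n ≠ 0} ∈ Filter.cofinite := by
    rw [Filter.mem_cofinite]
    exact (Set.finite_singleton (0 : ℤ)).subset fun n hn => by simpa using hn
  filter_upwards [hfin] with n hn
  have hn1 : (1 : ℝ) ≤ (n : ℝ) ^ 2 := by
    have : (1 : ℤ) ≤ n ^ 2 := by
      have := sq_pos_of_ne_zero (a := n) hn
      omega
    exact_mod_cast this
  have hn0 : (0 : ℝ) < (n : ℝ) ^ 2 := by linarith
  rw [Real.norm_of_nonneg (by positivity), mul_one_div, le_div_iff₀ hn0]
  have hw : (1 + (n : ℝ) ^ 2) ^ s ≤ 2 ^ m * ((n : ℝ) ^ 2) ^ m := by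
    calc (1 + (n : ℝ) ^ 2) ^ s ≤ (1 + (n : ℝ) ^ 2) ^ (m : ℝ) :=
          Real.rpow_le_rpow_of_exponent_le (by linarith) (Nat.le_ceil s)
      _ = (1 + (n : ℝ) ^ 2) ^ m := Real.rpow_natCast _ _
      _ ≤ (2 * (n : ℝ) ^ 2) ^ m := by
          gcongr
          linarith
      _ = _ := mul_pow _ _ _
  calc (1 + (n : ℝ) ^ 2) ^ s * ‖fourierCoeff q n‖ ^ 2 * (n : ℝ) ^ 2
      ≤ 2 ^ m * ((n : ℝ) ^ 2) ^ m * ‖fourierCoeff q n‖ ^ 2 * (n : ℝ) ^ 2 := by gcongr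
    _ = 2 ^ m * (|(n : ℝ)| ^ (m + 1) * ‖fourierCoeff q n‖) ^ 2 := by
        rw [mul_pow, pow_right_comm |(n : ℝ)|, sq_abs]
        ring
    _ ≤ 2 ^ m * C ^ 2 := by
        gcongr
        exact hC n

theorem converges_of_sobolevNorm_le {κ₀ s : ℝ} (hκ₀ : 0 < κ₀) (hs : 0 < s) :
    ∃ C > (0 : ℝ), ∀ (κ : ℝ) (hκ : 0 < κ) (q : C(T, ℂ)), IsSmooth q → κ₀ ≤ κ →
      C * sobolevNorm s q ^ (1 / min (1 / 4) s) ≤ κ →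
        AlphaSeriesConvergesGeometrically κ (laxOp κ hκ q) (1 / 2) ∧
        HasSum (fun l : ℕ => (alphaTerm κ (laxOp κ hκ q) (l + 1)).re) (alpha κ hκ q) := by
  set a := min (1 / 4) s
  have ha : 0 < a := lt_min (by norm_num) hs
  have ha4 : a ≤ 1 / 4 := min_le_left _ _
  have has : a ≤ s := min_le_right _ _
  set D₁ := (κ₀ ^ (1 - 2 * a))⁻¹ + 4
  set D₂ := 1 / κ₀ + 4
  have hD₁ : 0 < D₁ := by positivity
  have hD₂ : 0 < D₂ := by positivity
  obtain ⟨C, hC, hCS⟩ := exists_const_of_scaling ha (D := √D₁ + √D₂) (by positivity)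
  refine ⟨C, hC, fun κ hκ q hsm hκκ hq => ?_⟩
  set S := sobolevNorm s q
  have hS : 0 ≤ S := Real.sqrt_nonneg _
  set w : ℤ → ℝ := fun n => (1 + (n : ℝ) ^ 2) ^ s
  have hw : ∀ n, 0 < w n := fun n => by positivity
  have hsum : Summable fun n => w n * ‖fourierCoeff q n‖ ^ 2 := summable_sobolev_weight s q hsm
  have hnn : ∀ n, 0 ≤ w n * ‖fourierCoeff q n‖ ^ 2 := fun n => by positivity
  have hS2 : ∑' n, w n * ‖fourierCoeff q n‖ ^ 2 ≤ S ^ 2 := by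
    have h1 : S ^ 2 = 2 * Real.pi * ∑' n, w n * ‖fourierCoeff q n‖ ^ 2 := by
      rw [← tsum_mul_left]
      refine (Real.sq_sqrt (tsum_nonneg fun n => by positivity)).trans (tsum_congr fun n => ?_)
      ring
    rw [h1]
    exact le_mul_of_one_le_left (tsum_nonneg hnn) (by linarith [Real.pi_gt_three])
  set B := Finset.Icc (-⌊κ⌋₊ : ℤ) ⌊κ⌋₊
  set g : C(T, ℂ) := ∑ m ∈ B, fourierCoeff q m • fourier m with hg
  have hlow : ∑ n ∈ B, ‖fourierCoeff q n‖ ≤ √D₁ * κ ^ (1 / 2 - a) * S := by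
    have hcs := Real.sum_mul_le_sqrt_mul_sqrt B (fun n => (√(w n))⁻¹)
      (fun n => √(w n) * ‖fourierCoeff q n‖)
    have e1 : ∀ n, (√(w n))⁻¹ * (√(w n) * ‖fourierCoeff q n‖) = ‖fourierCoeff q n‖ := fun n =>
      inv_mul_cancel_left₀ (Real.sqrt_pos.2 (hw n)).ne' _
    have e2 : ∀ n, (√(w n))⁻¹ ^ 2 = (w n)⁻¹ := fun n => by
      rw [inv_pow, Real.sq_sqrt (hw n).le]
    have e3 : ∀ n, (√(w n) * ‖fourierCoeff q n‖) ^ 2 = w n * ‖fourierCoeff q n‖ ^ 2 := fun n => by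
      rw [mul_pow, Real.sq_sqrt (hw n).le]
    simp only [e1, e2, e3] at hcs
    refine hcs.trans (mul_le_mul ?_ ?_ (Real.sqrt_nonneg _) (by positivity))
    · refine Real.sqrt_le_iff.2 ⟨by positivity, ?_⟩
      refine (sum_sobolev_weight_inv_le ha ha4 has hκ₀ hκκ).trans_eq ?_
      rw [mul_pow, Real.sq_sqrt hD₁.le, ← Real.rpow_natCast (κ ^ (1 / 2 - a)),
        ← Real.rpow_mul hκ.le, show (1 / 2 - a) * (2 : ℕ) = 1 - 2 * a by push_cast; ring]
    · refine Real.sqrt_le_iff.2 ⟨hS, ?_⟩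
      exact (hsum.sum_le_tsum B fun n _ => hnn n).trans hS2
  have hgB : ∀ x, ‖g x‖ ≤ √D₁ * κ ^ (1 / 2 - a) * S := fun x => by
    refine le_trans ?_ hlow
    rw [hg, ContinuousMap.sum_apply]
    refine (norm_sum_le _ _).trans_eq (Finset.sum_congr rfl fun n _ => ?_)
    rw [ContinuousMap.smul_apply, norm_smul, fourier_apply, Circle.norm_coe, mul_one]
  have hhigh : √(∫ x, ‖(q - g) x‖ ^ 2 ∂(haarAddCircle : Measure T)) ≤ κ ^ (-a) * S := by
    refine Real.sqrt_le_iff.2 ⟨by positivity, ?_⟩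
    have hκa : (κ ^ (-a)) ^ 2 = (κ ^ (2 * a))⁻¹ := by
      rw [← Real.rpow_natCast, ← Real.rpow_mul hκ.le, ← Real.rpow_neg hκ.le]
      norm_num
      ring_nf
    rw [mul_pow, hκa]
    refine le_trans ?_ (mul_le_mul_of_nonneg_left hS2 (by positivity))
    rw [← tsum_mul_left]
    refine hasSum_le (fun n => ?_) (hasSum_norm_sq_fourierCoeff (q - g))
      (hsum.mul_left _).hasSum
    rw [hg, fourierCoeff_sub_partialSum]
    split_ifs with hn
    · rw [norm_zero, zero_pow two_ne_zero]
      exact mul_nonneg (by positivity) (hnn n)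
    -- Taking the floor of κ as cutoff loses nothing: an integer with |n| < κ satisfies |n| ≤ ⌊κ⌋₊.
    · have hκn : κ ≤ |(n : ℝ)| := by
        by_contra hlt
        push Not at hlt
        refine hn ?_
        have : n.natAbs ≤ ⌊κ⌋₊ := Nat.le_floor (by
          rw [Nat.cast_natAbs, Int.cast_abs]
          exact hlt.le)
        rw [Finset.mem_Icc]
        omega
      have := rpow_le_sobolev_weight ha has hκ hκn
      rw [← mul_assoc]
      refine le_mul_of_one_le_left (by positivity) ?_
      rw [inv_mul_eq_div, one_le_div (by positivity)]
      exact this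
  refine laxOp_converges_of_split hκ₀ hκκ hκ q g (q - g) (by simp) hgB (by positivity)
    (le_trans ?_ (hCS κ hκ S hS hq))
  have hK : √(D₂ * κ⁻¹) = √D₂ * κ ^ (-(1 / 2) : ℝ) := by
    rw [Real.sqrt_mul hD₂.le, Real.sqrt_eq_rpow κ⁻¹, Real.rpow_neg hκ.le, Real.inv_rpow hκ.le]
  gcongr
  calc √D₁ * κ ^ (1 / 2 - a) * S * κ⁻¹ +
        √(D₂ * κ⁻¹) * √(∫ x, ‖(q - g) x‖ ^ 2 ∂(haarAddCircle : Measure T))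
      ≤ √D₁ * κ ^ (1 / 2 - a) * S * κ⁻¹ + √D₂ * κ ^ (-(1 / 2) : ℝ) * (κ ^ (-a) * S) := by
        rw [hK]; gcongr
    _ = √D₁ * (κ ^ (1 / 2 - a) * κ ^ (-1 : ℝ)) * S +
        √D₂ * (κ ^ (-(1 / 2) : ℝ) * κ ^ (-a)) * S := by
        rw [Real.rpow_neg_one]; ring
    _ = (√D₁ + √D₂) * κ ^ (-(1 / 2) - a : ℝ) * S := by
        rw [← Real.rpow_add hκ, ← Real.rpow_add hκ]
        ring_nf

end Torus

end

theorem mainTheorem3 :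
    -- the line
    (∃ c > (0 : ℝ), ∃ r ∈ Set.Ico (0 : ℝ) 1, ∀ (κ : ℝ) (hκ : 0 < κ) (q : 𝓢(ℝ, ℂ)),
      Line.l2Norm q ≤ c →
        AlphaSeriesConvergesGeometrically κ (Line.laxOp κ hκ q) r ∧
        HasSum (fun l : ℕ => (alphaTerm κ (Line.laxOp κ hκ q) (l + 1)).re) (Line.alpha κ hκ q)) ∧
    (∀ s > (0 : ℝ), ∃ C > (0 : ℝ), ∃ r ∈ Set.Ico (0 : ℝ) 1,
      ∀ (κ : ℝ) (hκ : 0 < κ) (q : 𝓢(ℝ, ℂ)),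
      C * Line.sobolevNorm s q ^ (1 / min (1 / 4) s) ≤ κ →
        AlphaSeriesConvergesGeometrically κ (Line.laxOp κ hκ q) r ∧
        HasSum (fun l : ℕ => (alphaTerm κ (Line.laxOp κ hκ q) (l + 1)).re) (Line.alpha κ hκ q)) ∧
    -- the circle
    (∀ κ₀ > (0 : ℝ), ∃ c > (0 : ℝ), ∃ r ∈ Set.Ico (0 : ℝ) 1,
      ∀ (κ : ℝ) (hκ : 0 < κ) (q : C(Torus.T, ℂ)), Torus.IsSmooth q → κ₀ ≤ κ →
      Torus.l2Norm q ≤ c →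
        AlphaSeriesConvergesGeometrically κ (Torus.laxOp κ hκ q) r ∧
        HasSum (fun l : ℕ => (alphaTerm κ (Torus.laxOp κ hκ q) (l + 1)).re)
          (Torus.alpha κ hκ q)) ∧
    (∀ κ₀ > (0 : ℝ), ∀ s > (0 : ℝ), ∃ C > (0 : ℝ), ∃ r ∈ Set.Ico (0 : ℝ) 1,
      ∀ (κ : ℝ) (hκ : 0 < κ) (q : C(Torus.T, ℂ)), Torus.IsSmooth q → κ₀ ≤ κ →
      C * Torus.sobolevNorm s q ^ (1 / min (1 / 4) s) ≤ κ →
        AlphaSeriesConvergesGeometrically κ (Torus.laxOp κ hκ q) r ∧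
        HasSum (fun l : ℕ => (alphaTerm κ (Torus.laxOp κ hκ q) (l + 1)).re)
          (Torus.alpha κ hκ q)) := by
  refine ⟨⟨1, one_pos, 1 / 2, by norm_num, fun κ hκ q hq => Line.converges_of_l2Norm_le hκ q hq⟩,
    fun s hs => ?_, fun κ₀ hκ₀ => ?_, fun κ₀ hκ₀ s hs => ?_⟩
  · obtain ⟨C, hC, h⟩ := Line.converges_of_sobolevNorm_le hs
    exact ⟨C, hC, 1 / 2, by norm_num, h⟩
  · obtain ⟨c, hc, h⟩ := Torus.converges_of_l2Norm_le hκ₀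
    exact ⟨c, hc, 1 / 2, by norm_num, fun κ hκ q _ hκκ hq => h κ hκ q hκκ hq⟩
  · obtain ⟨C, hC, h⟩ := Torus.converges_of_sobolevNorm_le hκ₀ hs
    exact ⟨C, hC, 1 / 2, by norm_num, h⟩
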